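/- Let $m,n\ge 1$ and let $\mathbf{x},\mathbf{y}\in\mathbb{R}^n$ be nonzero vectors with angle $\theta\in[0,\pi]$ between them. Let $K^{\mathrm{ang}}(\mathbf{x},\mathbf{y})=1-\frac{2\theta}{\pi}$ be the angular kernel. For a random matrix $\mathbf{M}\in\mathbb{R}^{m\times n}$, consider the estimator $$\widehat{K}^{\mathrm{ang},\mathbf{M}}_m(\mathbf{x},\mathbf{y})=\frac1m\,\mathrm{sign}(\mathbf{M}\mathbf{x})^\top\mathrm{sign}(\mathbf{M}\mathbf{y})$$ of $K^{\mathrm{ang}}(\mathbf{x},\mathbf{y})$, where $\mathrm{sign}$ acts coordinatewise with $\mathrm{sign}(t)=1$ for $t>0$ and $\mathrm{sign}(t)=-1$ otherwise. Its mean squared error is $\mathrm{MSE}(\widehat{K}^{\mathrm{ang},\mathbf{M}}_m(\mathbf{x},\mathbf{y}))=\mathbb{E}\big[(\widehat{K}^{\mathrm{ang},\mathbf{M}}_m(\mathbf{x},\mathbf{y})-K^{\mathrm{ang}}(\mathbf{x},\mathbf{y}))^2\big]$. Let $\widehat{K}^{\mathrm{ang},\mathrm{base}}_m$ be the estimator with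 $\mathbf{M}=\mathbf{G}$, the $m\times n$ matrix with iid $\mathcal{N}(0,1)$ entries. Let $\widehat{K}^{\mathrm{ang},\mathrm{ort}}_m$ be the estimator with $\mathbf{M}=\mathbf{G}_{\mathrm{ort}}$, the Gaussian orthogonal matrix, defined as follows. A square $n\times n$ block has as its rows a uniformly (Haar) distributed random orthonormal basis of $\mathbb{R}^n$, each row then being multiplied by a $\chi_n$-distributed scalar (the law of the Euclidean norm of an $\mathcal{N}(0,I_n)$ vector), these $n$ scalars being independent of each other and of the basis. The $m\times n$ matrix $\mathbf{G}_{\mathrm{ort}}$ consists of the first $m$ rows of a stack of independent copies of such blocks (of one block if $m\le n$). Then $\widehat{K}^{\mathrm{ang},\mathrm{ort}}_m(\mathbf{x},\mathbf{y})$ is unbiased, i.e. $\mathbb{E}\big[\widehat{K}^{\mathrm{ang},\mathrm{ort}}_m(\mathbf{x},\mathbf{y})\big]=K^{\mathrm{ang}}(\mathbf{x},\mathbf{y})$. If moreover $m\ge 2$ and $\mathbf{x},\mathbf{y}$ are linearly independent, then $$\mathrm{MSE}\big(\widehat{K}^{\mathrm{ang},\mathrm{ort}}_m(\mathbf{x},\mathbf{y})\big)<\mathrm{MSE}\big(\widehat{K}^{\mathrm{ang},\mathrm{base}}_m(\mathbf{x},\mathbf{y})\big).$$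 -/

import Mathlib

open MeasureTheory ProbabilityTheory Matrix

/-- Matrices carry the product (entrywise) sigma-algebra, which is the Borel one. -/
instance matrixMeasurableSpace (m n : ℕ) : MeasurableSpace (Matrix (Fin m) (Fin n) ℝ) :=
  inferInstanceAs (MeasurableSpace (Fin m → Fin n → ℝ))

instance matrixBorelSpace (m n : ℕ) : BorelSpace (Matrix (Fin m) (Fin n) ℝ) :=
  inferInstanceAs (BorelSpace (Fin m → Fin n → ℝ))

/-- The real orthogonal group `O(n)` is compact. -/
instance orthogonalGroup_compactSpace (n : ℕ) :
    CompactSpace (Matrix.orthogonalGroup (Fin n) ℝ) := by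
  refine isCompact_iff_compactSpace.mp ?_
  have hK : IsCompact (Set.pi Set.univ fun _ : Fin n =>
      Set.pi Set.univ fun _ : Fin n => Set.Icc (-1 : ℝ) 1) :=
    isCompact_univ_pi fun _ => isCompact_univ_pi fun _ => isCompact_Icc
  refine IsCompact.of_isClosed_subset (s := (Set.pi Set.univ fun _ : Fin n =>
      Set.pi Set.univ fun _ : Fin n => Set.Icc (-1 : ℝ) 1)) hK ?_ ?_
  · have h : {A : Matrix (Fin n) (Fin n) ℝ | A ∈ Matrix.orthogonalGroup (Fin n) ℝ}
        = {A | A * Aᵀ = 1} := by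
      ext A; exact Matrix.mem_orthogonalGroup_iff _ _
    change IsClosed {A : Matrix (Fin n) (Fin n) ℝ | A ∈ Matrix.orthogonalGroup (Fin n) ℝ}
    rw [h]
    exact isClosed_eq (by fun_prop) continuous_const
  · intro A hA i _ j _
    exact abs_le.mp (entry_norm_bound_of_unitary (𝕜 := ℝ) hA i j)

/-- The uniform distribution on orthonormal bases of `ℝⁿ` (the rows of a random orthogonal
matrix): the Haar measure of `O(n)`, normalised to have total mass one. -/
noncomputable def uniformOrthogonal (n : ℕ) : Measure (Matrix.orthogonalGroup (Fin n) ℝ) :=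
  Measure.haarMeasure ⊤

/-- The `χ_n` distribution: the law of the Euclidean norm of an `N(0, I_n)` vector. -/
noncomputable def chiLaw (n : ℕ) : Measure ℝ :=
  (stdGaussian (EuclideanSpace ℝ (Fin n))).map fun g => ‖g‖

/-- The law of the unstructured `m × n` Gaussian matrix `G`, with iid `N(0,1)` entries. -/
noncomputable def gaussianLaw (m n : ℕ) : Measure (Matrix (Fin m) (Fin n) ℝ) :=
  Measure.pi fun _ : Fin m => Measure.pi fun _ : Fin n => gaussianReal 0 1

/-- The law of the square matrix `G_ort`: a uniformly random orthonormal basis as rows, the rows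
then being scaled by independent `χ_n` variables, so that each row has law `N(0, I_n)`. -/
noncomputable def gaussianOrthogonalBlockLaw (n : ℕ) : Measure (Matrix (Fin n) (Fin n) ℝ) :=
  ((uniformOrthogonal n).prod (Measure.pi fun _ : Fin n => chiLaw n)).map
    fun p => Matrix.diagonal p.2 * (p.1 : Matrix (Fin n) (Fin n) ℝ)

/-- Stack `n × n` blocks on top of each other and keep the first `m` rows of the result
(`m` blocks are always enough; for `m ≤ n` only rows of the first block are used). -/
def stackRows (m n : ℕ) (B : Fin m → Matrix (Fin n) (Fin n) ℝ) : Matrix (Fin m) (Fin n) ℝ :=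
  Matrix.of fun i j =>
    B ⟨(i : ℕ) / n, (Nat.div_le_self _ _).trans_lt i.isLt⟩ ⟨(i : ℕ) % n, Nat.mod_lt _ j.pos⟩ j

/-- The law of the `m × n` matrix `G_ort`: independent square copies are stacked and the
superfluous rows are deleted. -/
noncomputable def gaussianOrthogonalLaw (m n : ℕ) : Measure (Matrix (Fin m) (Fin n) ℝ) :=
  (Measure.pi fun _ : Fin m => gaussianOrthogonalBlockLaw n).map (stackRows m n)

/-- `sgn t = +1` if `t > 0` and `-1` otherwise. -/
noncomputable def sgn (t : ℝ) : ℝ := if 0 < t then 1 else -1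

/-- The angular kernel `K(x, y) = 1 - 2 θ / π`, where `θ` is the angle between `x` and `y`. -/
noncomputable def angularKernel {n : ℕ} (x y : EuclideanSpace ℝ (Fin n)) : ℝ :=
  1 - 2 * InnerProductGeometry.angle x y / Real.pi

/-- The random feature estimator `(1/m) sgn(Mx)ᵀ sgn(My)`, with `sgn` applied coordinatewise. -/
noncomputable def angularEstimator {m n : ℕ} (M : Matrix (Fin m) (Fin n) ℝ)
    (x y : EuclideanSpace ℝ (Fin n)) : ℝ :=
  (1 / (m : ℝ)) *
    ((fun i => sgn ((M *ᵥ x.ofLp) i)) ⬝ᵥ (fun i => sgn ((M *ᵥ y.ofLp) i)))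

/-- The random variable `X` is an unbiased estimator of the number `k`. -/
def IsUnbiased {Ω : Type*} [MeasurableSpace Ω] (P : Measure Ω) (X : Ω → ℝ) (k : ℝ) : Prop :=
  Integrable X P ∧ ∫ ω, X ω ∂P = k

/-- The mean squared error `E[(X - k)²]` of the estimator `X` of the number `k`. -/
noncomputable def MSE {Ω : Type*} [MeasurableSpace Ω] (P : Measure Ω) (X : Ω → ℝ) (k : ℝ) : ℝ :=
  ∫ ω, (X ω - k) ^ 2 ∂P

/-! Write `s_k` for the product of the signs of row `k` against `x` and `y`. The estimator is the
average of the `s_k`, each of mean `K = angularKernel x y` in both models: signs ignore the positive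
row lengths, the direction of a single row is that of a Gaussian vector, and Grothendieck's identity
applies. The mean squared error is therefore the sum of `E[s_k s_l] - K²` divided by `m²`. Diagonal
terms agree in both models, and rows that are independent contribute zero. Everything reduces to
`E[s_k s_l] < K²` for two distinct rows of one orthogonal block (`signCorr_orthogonal_lt`).

For a unit vector `w`, let `signCorr x y i w` correlate the sign products of `eᵢᵀ O` and `wᵀ O`,
with `O` Haar distributed. Averaged over a uniform `w` this is `K²` (`integral_signCorr`), so it
suffices that `w ⊥ eᵢ` minimises it and that the minimum is not attained almost everywhere.

By invariance only the angle `γ` between `eᵢ` and `w` matters, and one may average over rotations of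
the plane of two rows. On the unit circle of that plane the signs against `x` and `y` are square
waves with phases `α` and `β`, so the correlation is a mean of `waveCorr₄ α β γ` over random phases.
For signs `u, v, ε` one has `uv ≥ ε(u + v) - 1`; integrating gives `waveCorr₄ α β γ ≥ 2|waveCorr (β
- α)| - 2π`. At `γ = π/2` the waves multiply to waves of double frequency and this bound is
attained, which proves minimality pointwise in `α, β` (`waveCorr₄_quarter_le`).

For strictness, the same inequality with the factors regrouped yields `signCorr ≥ 1 - 4γ/π`
(`le_signCorr`), while the orthogonal value is below `1` (`signCorr_orthogonal_lt_one`). Hence all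
`w` close to `eᵢ` exceed the minimum, and they have positive measure. -/

/-! ### Signs and the square wave. -/

theorem sgn_eq_one_or (t : ℝ) : sgn t = 1 ∨ sgn t = -1 := by
  unfold sgn; split_ifs <;> simp

theorem sgn_mul_self (t : ℝ) : sgn t * sgn t = 1 := by
  rcases sgn_eq_one_or t with h | h <;> simp [h]

theorem sgn_of_pos {t : ℝ} (h : 0 < t) : sgn t = 1 := if_pos h

theorem sgn_of_nonpos {t : ℝ} (h : t ≤ 0) : sgn t = -1 := if_neg h.not_gt

theorem abs_sgn (t : ℝ) : |sgn t| = 1 := by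
  rcases sgn_eq_one_or t with h | h <;> simp [h]

theorem measurable_sgn : Measurable sgn :=
  Measurable.ite measurableSet_Ioi measurable_const measurable_const

theorem sgn_pos_mul {c : ℝ} (hc : 0 < c) (t : ℝ) : sgn (c * t) = sgn t := by
  unfold sgn; simp only [mul_pos_iff_of_pos_left hc]

theorem sgn_mul {s t : ℝ} (hs : s ≠ 0) (ht : t ≠ 0) : sgn (s * t) = sgn s * sgn t := by
  rcases lt_or_gt_of_ne hs with h | h <;> rcases lt_or_gt_of_ne ht with h' | h'
  · simp [sgn_of_pos (mul_pos_of_neg_of_neg h h'), sgn_of_nonpos h.le, sgn_of_nonpos h'.le]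
  · simp [sgn_of_nonpos (mul_neg_of_neg_of_pos h h').le, sgn_of_nonpos h.le, sgn_of_pos h']
  · simp [sgn_of_nonpos (mul_neg_of_pos_of_neg h h').le, sgn_of_nonpos h'.le, sgn_of_pos h]
  · simp [sgn_of_pos (mul_pos h h'), sgn_of_pos h, sgn_of_pos h']

/-- The square wave `sgn ∘ cos`. -/
noncomputable def signWave (t : ℝ) : ℝ := sgn (Real.cos t)

theorem measurable_signWave : Measurable signWave := measurable_sgn.comp Real.measurable_cos

theorem signWave_periodic : Function.Periodic signWave (2 * Real.pi) := fun t => by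
  simp [signWave]

theorem signWave_neg (t : ℝ) : signWave (-t) = signWave t := by simp [signWave]

theorem signWave_eq_one {t : ℝ} (h₁ : -(Real.pi / 2) < t) (h₂ : t < Real.pi / 2) :
    signWave t = 1 := sgn_of_pos (Real.cos_pos_of_mem_Ioo ⟨h₁, h₂⟩)

theorem signWave_eq_neg_one {t : ℝ} (h₁ : Real.pi / 2 ≤ t) (h₂ : t ≤ Real.pi + Real.pi / 2) :
    signWave t = -1 := sgn_of_nonpos (Real.cos_nonpos_of_pi_div_two_le_of_le h₁ h₂)

theorem signWave_mem (t : ℝ) : signWave t = 1 ∨ signWave t = -1 := sgn_eq_one_or _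

theorem intervalIntegrable_of_abs_le_one {f : ℝ → ℝ} (hf : Measurable f) (h : ∀ t, |f t| ≤ 1)
    (a b : ℝ) : IntervalIntegrable f volume a b :=
  (intervalIntegrable_const (c := (1 : ℝ))).mono_fun hf.aestronglyMeasurable
    (ae_of_all _ fun t => by simpa using h t)

/-! ### Autocorrelation of the square wave: a triangular wave. -/

/-- The autocorrelation of the square wave over one period. -/
noncomputable def waveCorr (t : ℝ) : ℝ :=
  ∫ φ in (0 : ℝ)..(2 * Real.pi), signWave φ * signWave (φ - t)

theorem abs_signWave_mul (s t : ℝ) : |signWave s * signWave t| ≤ 1 := by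
  rw [abs_mul, signWave, signWave, abs_sgn, abs_sgn, one_mul]

theorem integral_period_eq {f : ℝ → ℝ} (hf : Function.Periodic f (2 * Real.pi)) (a : ℝ) :
    ∫ φ in a..(a + 2 * Real.pi), f φ = ∫ φ in (0 : ℝ)..(2 * Real.pi), f φ := by
  simpa using hf.intervalIntegral_add_eq a 0

theorem integral_eq_of_eqOn_Ioo {f : ℝ → ℝ} {a b c : ℝ} (hab : a ≤ b)
    (h : ∀ t, a < t → t < b → f t = c) : ∫ t in a..b, f t = (b - a) * c := by
  rw [intervalIntegral.integral_of_le hab, integral_Ioc_eq_integral_Ioo,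
    setIntegral_congr_fun (g := fun _ => c) measurableSet_Ioo fun t ht => h t ht.1 ht.2]
  simp [hab]

/-- Over the period starting at `-π/2` the sign changes occur at `t - π/2`, `π/2` and `π/2 + t`. The
product is `-1, 1, -1, 1` on intervals of lengths `t, π - t, t, π - t`. -/
theorem waveCorr_of_mem {t : ℝ} (h₀ : 0 ≤ t) (h₁ : t ≤ Real.pi) :
    waveCorr t = 2 * Real.pi - 4 * t := by
  have hper : Function.Periodic (fun φ => signWave φ * signWave (φ - t)) (2 * Real.pi) :=
    fun φ => by
      have := signWave_periodic (φ - t)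
      simp only [signWave_periodic φ]
      rw [← this]; ring_nf
  have hint : ∀ a b, IntervalIntegrable (fun φ => signWave φ * signWave (φ - t)) volume a b :=
    intervalIntegrable_of_abs_le_one (measurable_signWave.mul
      (measurable_signWave.comp (measurable_id.sub_const t))) fun φ => abs_signWave_mul _ _
  have hneg : ∀ s, -(Real.pi + Real.pi / 2) ≤ s → s ≤ -(Real.pi / 2) → signWave s = -1 :=
    fun s h h' => by
      rw [← signWave_neg]; exact signWave_eq_neg_one (by linarith) (by linarith)
  have hpi := Real.pi_pos
  rw [waveCorr, ← integral_period_eq hper (-(Real.pi / 2)),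
    ← intervalIntegral.integral_add_adjacent_intervals
      (hint _ (t - Real.pi / 2)) (hint _ _),
    ← intervalIntegral.integral_add_adjacent_intervals
      (hint (t - Real.pi / 2) (Real.pi / 2)) (hint _ _),
    ← intervalIntegral.integral_add_adjacent_intervals
      (hint (Real.pi / 2) (Real.pi / 2 + t)) (hint _ _),
    integral_eq_of_eqOn_Ioo (c := -1) (by linarith) fun φ h h' => by
      rw [signWave_eq_one h (by linarith), hneg _ (by linarith) (by linarith)]; norm_num,
    integral_eq_of_eqOn_Ioo (c := 1) (by linarith) fun φ h h' => by
      rw [signWave_eq_one (by linarith) h', signWave_eq_one (by linarith) (by linarith)]; norm_num,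
    integral_eq_of_eqOn_Ioo (c := -1) (by linarith) fun φ h h' => by
      rw [signWave_eq_neg_one h.le (by linarith), signWave_eq_one (by linarith) (by linarith)]
      norm_num,
    integral_eq_of_eqOn_Ioo (c := 1) (by linarith) fun φ h h' => by
      rw [signWave_eq_neg_one (by linarith) (by linarith),
        signWave_eq_neg_one (by linarith) (by linarith)]
      norm_num]
  ring

theorem waveCorr_periodic : Function.Periodic waveCorr (2 * Real.pi) := fun t => by
  unfold waveCorr
  refine intervalIntegral.integral_congr fun φ _ => ?_
  rw [← signWave_periodic (φ - (t + 2 * Real.pi))]; ring_nf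

/-- Shifting the wave product leaves its integral over a period unchanged. -/
theorem integral_signWave_sub_mul (a b : ℝ) :
    ∫ φ in (0 : ℝ)..(2 * Real.pi), signWave (φ - a) * signWave (φ - b) = waveCorr (b - a) := by
  have hper : Function.Periodic (fun φ => signWave φ * signWave (φ - (b - a))) (2 * Real.pi) :=
    fun φ => by
      have := signWave_periodic (φ - (b - a))
      simp only [signWave_periodic φ]
      rw [← this]; ring_nf
  have := intervalIntegral.integral_comp_sub_right (a := 0) (b := 2 * Real.pi)
    (fun φ => signWave φ * signWave (φ - (b - a))) a
  rw [waveCorr, ← integral_period_eq hper (0 - a),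
    show 0 - a + 2 * Real.pi = 2 * Real.pi - a by ring, ← this]
  refine intervalIntegral.integral_congr fun φ _ => ?_
  ring_nf

theorem waveCorr_neg (t : ℝ) : waveCorr (-t) = waveCorr t := by
  have h := integral_signWave_sub_mul t 0
  rw [zero_sub] at h
  rw [← h, waveCorr]
  refine intervalIntegral.integral_congr fun φ _ => ?_
  simp [mul_comm]

/-- Evenness and periodicity reduce `t` to its representative in `[0, π]`, which is `arccos (cos
t)`. -/
theorem waveCorr_eq (t : ℝ) : waveCorr t = 2 * Real.pi - 4 * Real.arccos (Real.cos t) := by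
  set τ := Real.arccos (Real.cos t) with hτ
  have hcos : Real.cos τ = Real.cos t :=
    Real.cos_arccos (Real.neg_one_le_cos t) (Real.cos_le_one t)
  rw [← waveCorr_of_mem (Real.arccos_nonneg _) (Real.arccos_le_pi _), ← hτ]
  obtain ⟨k, hk | hk⟩ := Real.cos_eq_cos_iff.1 hcos
  · rw [hk, show 2 * (k : ℝ) * Real.pi + τ = τ + k * (2 * Real.pi) by ring,
      waveCorr_periodic.int_mul k]
  · rw [hk, show 2 * (k : ℝ) * Real.pi - τ = -τ + k * (2 * Real.pi) by ring,
      waveCorr_periodic.int_mul k, waveCorr_neg]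

/-- Doubling the argument of a triangular wave folds it at its zeros. The two cases are the two
sides of the fold. -/
theorem waveCorr_two_mul_le (t : ℝ) : waveCorr (2 * t) ≤ 2 * |waveCorr t| - 2 * Real.pi := by
  rw [waveCorr_eq, waveCorr_eq t]
  set τ := Real.arccos (Real.cos t) with hτ
  have hcos : Real.cos τ = Real.cos t :=
    Real.cos_arccos (Real.neg_one_le_cos t) (Real.cos_le_one t)
  have h0 : 0 ≤ τ := Real.arccos_nonneg _
  have h1 : τ ≤ Real.pi := Real.arccos_le_pi _
  rw [Real.cos_two_mul, ← hcos, ← Real.cos_two_mul]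
  rcases le_total (2 * τ) Real.pi with h | h
  · rw [Real.arccos_cos (by linarith) h]
    linarith [le_abs_self (2 * Real.pi - 4 * τ)]
  · rw [← Real.cos_two_pi_sub, Real.arccos_cos (by linarith) (by linarith)]
    linarith [neg_le_abs (2 * Real.pi - 4 * τ)]

/-! ### Products of four square waves, minimal at a quarter-period shift. -/

/-- The integral over a period of a product of four square waves, in two pairs that are
`γ` apart. -/
noncomputable def waveCorr₄ (α β γ : ℝ) : ℝ :=
  ∫ φ in (0 : ℝ)..(2 * Real.pi),
    signWave (φ - α) * signWave (φ - β) * (signWave (φ + γ - α) * signWave (φ + γ - β))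

theorem intervalIntegrable_signWave_mul (a b c d : ℝ) :
    IntervalIntegrable (fun φ => signWave (φ - a) * signWave (φ - b)) volume c d :=
  intervalIntegrable_of_abs_le_one ((measurable_signWave.comp (measurable_id.sub_const _)).mul
      (measurable_signWave.comp (measurable_id.sub_const _))) (fun _ => abs_signWave_mul _ _) _ _

theorem intervalIntegrable_signWave_mul₄ (α β γ c d : ℝ) :
    IntervalIntegrable (fun φ => signWave (φ - α) * signWave (φ - β) *
      (signWave (φ + γ - α) * signWave (φ + γ - β))) volume c d := by
  refine intervalIntegrable_of_abs_le_one ?_ (fun φ => ?_) _ _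
  · have := measurable_signWave
    fun_prop
  · rw [abs_mul]
    exact mul_le_one₀ (abs_signWave_mul _ _) (abs_nonneg _) (abs_signWave_mul _ _)

/-- A lower bound of `waveCorr₄` through pairwise correlations, up to a common sign `ε`. -/
theorem le_waveCorr₄_of_pairs {α β γ ε a b c d : ℝ}
    (h : ∀ φ, ε * (signWave (φ - a) * signWave (φ - b)) +
      ε * (signWave (φ - c) * signWave (φ - d)) - 1 ≤
      signWave (φ - α) * signWave (φ - β) * (signWave (φ + γ - α) * signWave (φ + γ - β))) :
    ε * waveCorr (b - a) + ε * waveCorr (d - c) - 2 * Real.pi ≤ waveCorr₄ α β γ := by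
  have hi := intervalIntegrable_signWave_mul
  have := intervalIntegral.integral_mono_on (a := 0) (b := 2 * Real.pi) (μ := volume)
    (by positivity)
    ((((hi a b _ _).const_mul ε).add ((hi c d _ _).const_mul ε)).sub
      (intervalIntegrable_const (c := (1 : ℝ))))
    (intervalIntegrable_signWave_mul₄ α β γ _ _) fun _ _ => h _
  rw [intervalIntegral.integral_sub (((hi a b _ _).const_mul ε).add ((hi c d _ _).const_mul ε))
      intervalIntegrable_const, intervalIntegral.integral_add
      ((hi a b _ _).const_mul ε) ((hi c d _ _).const_mul ε)] at this
  simp only [intervalIntegral.integral_const_mul, integral_signWave_sub_mul] at this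
  simpa [waveCorr₄] using this

/-- Pair the two factors at `φ` and the two at `φ + γ`: with `u, v` the two products, `(u - ε)(v -
ε) ≥ 0`. Both pairs have correlation `waveCorr (β - α)`, and the better `ε = ±1` produces the
absolute value. -/
theorem le_waveCorr₄_angle (α β γ : ℝ) :
    2 * |waveCorr (β - α)| - 2 * Real.pi ≤ waveCorr₄ α β γ := by
  have key : ∀ ε : ℝ, ε = 1 ∨ ε = -1 →
      2 * (ε * waveCorr (β - α)) - 2 * Real.pi ≤ waveCorr₄ α β γ := fun ε hε => by
    have := le_waveCorr₄_of_pairs (α := α) (β := β) (γ := γ) (ε := ε) (a := α) (b := β)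
      (c := α - γ) (d := β - γ) fun φ => by
        rw [show φ - (α - γ) = φ + γ - α by ring, show φ - (β - γ) = φ + γ - β by ring]
        rcases signWave_mem (φ - α) with h₁ | h₁ <;> rcases signWave_mem (φ - β) with h₂ | h₂ <;>
        rcases signWave_mem (φ + γ - α) with h₃ | h₃ <;>
        rcases signWave_mem (φ + γ - β) with h₄ | h₄ <;>
        rcases hε with h₅ | h₅ <;> rw [h₁, h₂, h₃, h₄, h₅] <;> norm_num
    rw [show β - γ - (α - γ) = β - α by ring] at this
    linarith
  rcases abs_choice (waveCorr (β - α)) with h | h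
  · rw [h]; linarith [key 1 (Or.inl rfl)]
  · rw [h]; linarith [key (-1) (Or.inr rfl)]

/-- Same inequality with `ε = 1`, but pairing the two `α` factors and the two `β` factors, each pair
being `γ` apart. The bound is sharp as `γ → 0`. -/
theorem le_waveCorr₄_shift (α β γ : ℝ) :
    2 * waveCorr γ - 2 * Real.pi ≤ waveCorr₄ α β γ := by
  have := le_waveCorr₄_of_pairs (α := α) (β := β) (γ := γ) (ε := 1) (a := α) (b := α - γ)
      (c := β) (d := β - γ) fun φ => by
        rw [show φ - (α - γ) = φ + γ - α by ring, show φ - (β - γ) = φ + γ - β by ring]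
        rcases signWave_mem (φ - α) with h₁ | h₁ <;> rcases signWave_mem (φ - β) with h₂ | h₂ <;>
        rcases signWave_mem (φ + γ - α) with h₃ | h₃ <;>
        rcases signWave_mem (φ + γ - β) with h₄ | h₄ <;>
        rw [h₁, h₂, h₃, h₄] <;> norm_num
  rw [show β - γ - β = -γ by ring, show α - γ - α = -γ by ring, waveCorr_neg] at this
  linarith

theorem ae_cos_sub_ne_zero (a : ℝ) : ∀ᵐ φ : ℝ, Real.cos (φ - a) ≠ 0 := by
  have : {φ : ℝ | ¬ Real.cos (φ - a) ≠ 0} ⊆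
      Set.range fun k : ℤ => (2 * k + 1) * Real.pi / 2 + a := fun φ hφ => by
    obtain ⟨k, hk⟩ := Real.cos_eq_zero_iff.1 (not_not.1 hφ)
    exact ⟨k, by simp only [← hk]; ring⟩
  exact measure_mono_null this ((Set.countable_range _).measure_zero volume)

theorem ae_sin_sub_ne_zero (a : ℝ) : ∀ᵐ φ : ℝ, Real.sin (φ - a) ≠ 0 := by
  filter_upwards [ae_cos_sub_ne_zero (a + Real.pi / 2)] with φ h
  rwa [show φ - (a + Real.pi / 2) = φ - a - Real.pi / 2 by ring, Real.cos_sub_pi_div_two] at h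

/-- Two square waves a quarter period apart multiply to a square wave of half the period. -/
theorem signWave_mul_quarter {t : ℝ} (hc : Real.cos t ≠ 0) (hs : Real.sin t ≠ 0) :
    signWave t * signWave (t + Real.pi / 2) = signWave (2 * t + Real.pi / 2) := by
  unfold signWave
  rw [Real.cos_add_pi_div_two, Real.cos_add_pi_div_two, Real.sin_two_mul,
    ← sgn_mul hc (neg_ne_zero.2 hs), ← sgn_pos_mul (c := 2) two_pos]
  ring_nf

theorem waveCorr₄_quarter (α β : ℝ) :
    waveCorr₄ α β (Real.pi / 2) = waveCorr (2 * (β - α)) := by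
  have h1 : waveCorr₄ α β (Real.pi / 2) = ∫ φ in (0 : ℝ)..(2 * Real.pi),
      signWave (2 * φ - (2 * α - Real.pi / 2)) * signWave (2 * φ - (2 * β - Real.pi / 2)) := by
    refine intervalIntegral.integral_congr_ae ?_
    -- Zeros are excluded because `sgn 0 = -1` breaks multiplicativity of `sgn`.
    filter_upwards [ae_cos_sub_ne_zero α, ae_cos_sub_ne_zero β, ae_sin_sub_ne_zero α,
      ae_sin_sub_ne_zero β] with φ ha hb ha' hb' _
    rw [show 2 * φ - (2 * α - Real.pi / 2) = 2 * (φ - α) + Real.pi / 2 by ring,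
      show 2 * φ - (2 * β - Real.pi / 2) = 2 * (φ - β) + Real.pi / 2 by ring,
      ← signWave_mul_quarter ha ha', ← signWave_mul_quarter hb hb',
      show φ + Real.pi / 2 - α = φ - α + Real.pi / 2 by ring,
      show φ + Real.pi / 2 - β = φ - β + Real.pi / 2 by ring]
    ring
  rw [h1]
  set f : ℝ → ℝ := fun φ => signWave (φ - (2 * α - Real.pi / 2)) *
    signWave (φ - (2 * β - Real.pi / 2)) with hf
  have hper : Function.Periodic f (2 * Real.pi) := fun φ => by
    simp only [hf]
    rw [← signWave_periodic (φ - (2 * α - Real.pi / 2)),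
      ← signWave_periodic (φ - (2 * β - Real.pi / 2))]
    ring_nf
  have h2 : ∫ φ in (0 : ℝ)..(2 * Real.pi), f (2 * φ) =
      ∫ φ in (0 : ℝ)..(2 * Real.pi), f φ := by
    -- As `φ` runs through one period, `2 * φ` runs through two; the Jacobian `1/2` compensates.
    have hi := intervalIntegrable_signWave_mul (2 * α - Real.pi / 2) (2 * β - Real.pi / 2)
    have h3 := integral_period_eq hper (2 * Real.pi)
    rw [intervalIntegral.integral_comp_mul_left f two_ne_zero, mul_zero,
      ← intervalIntegral.integral_add_adjacent_intervals (hi 0 (2 * Real.pi)) (hi _ _),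
      show 2 * (2 * Real.pi) = 2 * Real.pi + 2 * Real.pi by ring]
    change (2 : ℝ)⁻¹ • ((∫ φ in (0 : ℝ)..(2 * Real.pi), f φ) + ∫ φ in _.._, f φ) = _
    rw [h3, smul_eq_mul]
    ring
  change ∫ φ in (0 : ℝ)..(2 * Real.pi), f (2 * φ) = _
  rw [h2, integral_signWave_sub_mul]
  ring_nf

theorem waveCorr₄_quarter_le (α β γ : ℝ) :
    waveCorr₄ α β (Real.pi / 2) ≤ waveCorr₄ α β γ := by
  rw [waveCorr₄_quarter]
  exact (waveCorr_two_mul_le _).trans (le_waveCorr₄_angle α β γ)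

/-- Polar coordinates, in the form in which a rotated linear functional uses them. -/
theorem exists_sgn_rotate_eq {a b : ℝ} (h : a ≠ 0 ∨ b ≠ 0) :
    ∃ α, ∀ φ, sgn (Real.cos φ * a + Real.sin φ * b) = signWave (φ - α) := by
  set z : ℂ := ⟨a, b⟩
  have hz : z ≠ 0 := fun h0 => by
    rcases h with h | h
    · exact h (congrArg Complex.re h0)
    · exact h (congrArg Complex.im h0)
  refine ⟨z.arg, fun φ => ?_⟩
  have h1 : ‖z‖ * Real.cos z.arg = a := Complex.norm_mul_cos_arg z
  have h2 : ‖z‖ * Real.sin z.arg = b := Complex.norm_mul_sin_arg z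
  rw [← h1, ← h2, signWave, Real.cos_sub,
    show Real.cos φ * (‖z‖ * Real.cos z.arg) + Real.sin φ * (‖z‖ * Real.sin z.arg) =
      ‖z‖ * (Real.cos φ * Real.cos z.arg + Real.sin φ * Real.sin z.arg) by ring,
    sgn_pos_mul (norm_pos_iff.2 hz)]

/-! ### The orthogonal group acting on rows; Haar measure and Gaussian directions. -/

section rotate

variable {n : ℕ}

/-- An orthogonal matrix `O` acting on row vectors: `e ↦ eᵀ O`. -/
noncomputable def rowAct (O : Matrix.orthogonalGroup (Fin n) ℝ) (e : EuclideanSpace ℝ (Fin n)) :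
    EuclideanSpace ℝ (Fin n) :=
  WithLp.toLp 2 (e.ofLp ᵥ* (O : Matrix (Fin n) (Fin n) ℝ))

theorem rowAct_mul (Q O : Matrix.orthogonalGroup (Fin n) ℝ) (e : EuclideanSpace ℝ (Fin n)) :
    rowAct (Q * O) e = rowAct O (rowAct Q e) := by
  simp [rowAct, Matrix.vecMul_vecMul]

theorem rowAct_add (O : Matrix.orthogonalGroup (Fin n) ℝ) (e f : EuclideanSpace ℝ (Fin n)) :
    rowAct O (e + f) = rowAct O e + rowAct O f := by
  simp [rowAct, Matrix.add_vecMul]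

theorem rowAct_smul (O : Matrix.orthogonalGroup (Fin n) ℝ) (c : ℝ)
    (e : EuclideanSpace ℝ (Fin n)) : rowAct O (c • e) = c • rowAct O e := by
  simp [rowAct, Matrix.smul_vecMul]

theorem inner_eq_dotProduct (x y : EuclideanSpace ℝ (Fin n)) :
    inner ℝ x y = x.ofLp ⬝ᵥ y.ofLp := by
  rw [EuclideanSpace.inner_eq_star_dotProduct, dotProduct_comm]; simp

theorem inner_rowAct (O : Matrix.orthogonalGroup (Fin n) ℝ) (e f : EuclideanSpace ℝ (Fin n)) :
    inner ℝ (rowAct O e) (rowAct O f) = inner ℝ e f := by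
  have h : (O : Matrix (Fin n) (Fin n) ℝ) * (O : Matrix (Fin n) (Fin n) ℝ)ᵀ = 1 :=
    (Matrix.mem_orthogonalGroup_iff _ _).1 O.2
  simp only [inner_eq_dotProduct, rowAct]
  rw [← Matrix.dotProduct_mulVec, ← Matrix.mulVec_transpose, Matrix.mulVec_mulVec, h,
    Matrix.one_mulVec]

/-- `rowAct O` as a linear isometry. -/
noncomputable def rowActIsometry (O : Matrix.orthogonalGroup (Fin n) ℝ) :
    EuclideanSpace ℝ (Fin n) ≃ₗᵢ[ℝ] EuclideanSpace ℝ (Fin n) :=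
  LinearIsometry.toLinearIsometryEquiv
    (LinearMap.isometryOfInner
      { toFun := rowAct O
        map_add' := rowAct_add O
        map_smul' := rowAct_smul O } (inner_rowAct O)) rfl

theorem measurable_matrix_apply {m n : ℕ} (k : Fin m) (j : Fin n) :
    Measurable fun M : Matrix (Fin m) (Fin n) ℝ => M k j :=
  (measurable_pi_apply (X := fun _ : Fin n => ℝ) j).comp
    (measurable_pi_apply (X := fun _ : Fin m => Fin n → ℝ) k)

theorem measurable_rowAct_uncurry :
    Measurable fun p : Matrix.orthogonalGroup (Fin n) ℝ × EuclideanSpace ℝ (Fin n) =>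
      rowAct p.1 p.2 := by
  refine (WithLp.measurable_toLp 2 _).comp (measurable_pi_lambda _ fun j => ?_)
  simp only [Matrix.vecMul, dotProduct]
  refine Finset.measurable_sum _ fun k _ => Measurable.mul ?_ ?_
  · exact ((measurable_pi_apply k).comp (WithLp.measurable_ofLp 2 _)).comp measurable_snd
  · exact (measurable_matrix_apply k j).comp (measurable_subtype_coe.comp measurable_fst)

theorem measurable_rowAct_left (e : EuclideanSpace ℝ (Fin n)) :
    Measurable fun O : Matrix.orthogonalGroup (Fin n) ℝ => rowAct O e :=
  measurable_rowAct_uncurry.comp measurable_prodMk_right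

theorem continuous_rowAct_left (e : EuclideanSpace ℝ (Fin n)) :
    Continuous fun O : Matrix.orthogonalGroup (Fin n) ℝ => rowAct O e := by
  unfold rowAct
  refine (PiLp.continuous_toLp 2 _).comp ?_
  exact Continuous.matrix_vecMul continuous_const continuous_subtype_val

instance isProbabilityMeasure_uniformOrthogonal (n : ℕ) :
    IsProbabilityMeasure (uniformOrthogonal n) where
  measure_univ := Measure.haarMeasure_self

instance isHaarMeasure_uniformOrthogonal (n : ℕ) :
    (uniformOrthogonal n).IsHaarMeasure := by
  unfold uniformOrthogonal; infer_instance

/-- The orthogonal matrix with a given orthonormal basis as its rows. -/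
theorem exists_rowAct_basis (b : OrthonormalBasis (Fin n) ℝ (EuclideanSpace ℝ (Fin n))) :
    ∃ Q : Matrix.orthogonalGroup (Fin n) ℝ, ∀ k, rowAct Q (EuclideanSpace.single k 1) = b k := by
  refine ⟨⟨Matrix.of fun k j => b k j, ?_⟩, fun k => ?_⟩
  · rw [Matrix.mem_orthogonalGroup_iff]
    ext k l
    have := orthonormal_iff_ite.1 b.orthonormal k l
    rw [inner_eq_dotProduct] at this
    rw [Matrix.mul_apply, Matrix.one_apply, ← this]
    rfl
  · ext j
    simp [rowAct]

theorem exists_rowAct_single {e : EuclideanSpace ℝ (Fin n)} (he : ‖e‖ = 1) (i : Fin n) :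
    ∃ Q : Matrix.orthogonalGroup (Fin n) ℝ, rowAct Q (EuclideanSpace.single i 1) = e := by
  have hv : Orthonormal ℝ (({i} : Set (Fin n)).domRestrict fun _ => e) :=
    ⟨fun _ => he, fun a b hab => absurd (Subsingleton.elim a b) hab⟩
  obtain ⟨b, hb⟩ := hv.exists_orthonormalBasis_extension_of_card_eq (by simp)
  obtain ⟨Q, hQ⟩ := exists_rowAct_basis b
  exact ⟨Q, by rw [hQ, hb i rfl]⟩

/-- Transitivity of `O(n)` on orthonormal pairs: extend the pair to an orthonormal basis and use it
as rows. -/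
theorem exists_rowAct_pair {e f : EuclideanSpace ℝ (Fin n)} (he : ‖e‖ = 1) (hf : ‖f‖ = 1)
    (hef : inner ℝ e f = 0) {i j : Fin n} (hij : i ≠ j) :
    ∃ Q : Matrix.orthogonalGroup (Fin n) ℝ, rowAct Q (EuclideanSpace.single i 1) = e ∧
      rowAct Q (EuclideanSpace.single j 1) = f := by
  classical
  have hv : Orthonormal ℝ (({i, j} : Set (Fin n)).domRestrict fun k => if k = i then e else f) := by
    refine ⟨fun k => ?_, fun a b hab => ?_⟩
    · simp only [Set.domRestrict_apply]
      split_ifs <;> assumption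
    · obtain ⟨a, ha⟩ := a
      obtain ⟨b, hb⟩ := b
      have hab' : a ≠ b := fun h => hab (Subtype.ext h)
      simp only [Set.domRestrict_apply]
      rcases ha with rfl | ha <;> rcases hb with rfl | hb
      · exact absurd rfl hab'
      · rw [if_pos rfl, if_neg hab'.symm, hef]
      · rw [if_pos rfl, if_neg hab', real_inner_comm, hef]
      · exact absurd (ha.trans hb.symm) hab'
  obtain ⟨b, hb⟩ := hv.exists_orthonormalBasis_extension_of_card_eq (by simp)
  obtain ⟨Q, hQ⟩ := exists_rowAct_basis b
  exact ⟨Q, by rw [hQ, hb i (by simp), if_pos rfl], by rw [hQ, hb j (by simp), if_neg hij.symm]⟩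

theorem integral_rowAct_mul {F : Matrix.orthogonalGroup (Fin n) ℝ → ℝ}
    (Q : Matrix.orthogonalGroup (Fin n) ℝ) :
    ∫ O, F (Q * O) ∂uniformOrthogonal n = ∫ O, F O ∂uniformOrthogonal n :=
  integral_mul_left_eq_self F Q

/-- Any two orthonormal vectors are mapped by a uniform orthogonal matrix to the same law. -/
theorem integral_rowAct_pair (F : EuclideanSpace ℝ (Fin n) → EuclideanSpace ℝ (Fin n) → ℝ)
    {e f : EuclideanSpace ℝ (Fin n)} (he : ‖e‖ = 1) (hf : ‖f‖ = 1) (hef : inner ℝ e f = 0)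
    {i j : Fin n} (hij : i ≠ j) :
    ∫ O, F (rowAct O e) (rowAct O f) ∂uniformOrthogonal n =
      ∫ O, F (rowAct O (EuclideanSpace.single i 1)) (rowAct O (EuclideanSpace.single j 1))
        ∂uniformOrthogonal n := by
  obtain ⟨Q, rfl, rfl⟩ := exists_rowAct_pair he hf hef hij
  simp only [← rowAct_mul]
  exact integral_rowAct_mul (F := fun O => F (rowAct O _) (rowAct O _)) Q

theorem integral_stdGaussian_rowAct (F : EuclideanSpace ℝ (Fin n) → ℝ) 
    (O : Matrix.orthogonalGroup (Fin n) ℝ) :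
    ∫ g, F (rowAct O g) ∂stdGaussian (EuclideanSpace ℝ (Fin n)) =
      ∫ g, F g ∂stdGaussian (EuclideanSpace ℝ (Fin n)) := by
  conv_rhs => rw [← stdGaussian_map (rowActIsometry O)]
  exact ((rowActIsometry O).toHomeomorph.measurableEmbedding.integral_map F).symm

/-- The functional `⟨·, x⟩` has a Gaussian law of variance `‖x‖² > 0`, hence no atoms. -/
theorem stdGaussian_hyperplane {x : EuclideanSpace ℝ (Fin n)} (hx : x ≠ 0) :
    ∀ᵐ g ∂stdGaussian (EuclideanSpace ℝ (Fin n)), inner ℝ g x ≠ 0 := by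
  set L : StrongDual ℝ (EuclideanSpace ℝ (Fin n)) := innerSL ℝ x
  have hL : ‖L‖ ≠ 0 := by simpa [L] using hx
  have h1 := IsGaussian.map_eq_gaussianReal (μ := stdGaussian (EuclideanSpace ℝ (Fin n))) L
  rw [variance_dual_stdGaussian] at h1
  have : NullSingletonClass (gaussianReal ((stdGaussian (EuclideanSpace ℝ (Fin n)))[L])
    (‖L‖ ^ 2).toNNReal) := nullSingletonClass_gaussianReal (by simpa using hL)
  have h2 : ∀ᵐ t ∂(stdGaussian (EuclideanSpace ℝ (Fin n))).map L, t ≠ 0 := by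
    rw [h1, ae_iff]
    simpa only [ne_eq, not_not, Set.ofPred_eq_eq_singleton] using measure_singleton 0
  filter_upwards [ae_of_ae_map L.continuous.aemeasurable h2] with g hg
  rwa [real_inner_comm]

theorem stdGaussian_ne_zero (hn : 0 < n) :
    ∀ᵐ g ∂stdGaussian (EuclideanSpace ℝ (Fin n)), g ≠ 0 := by
  have hx : (EuclideanSpace.single (⟨0, hn⟩ : Fin n) (1 : ℝ)) ≠ 0 := by
    rw [← norm_ne_zero_iff]; simp
  filter_upwards [stdGaussian_hyperplane hx] with g hg h0
  exact hg (by simp [h0])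

theorem integrable_of_abs_le_one {α : Type*} [MeasurableSpace α] {μ : Measure α}
    [IsFiniteMeasure μ] {F : α → ℝ} (hF : Measurable F) (h : ∀ a, |F a| ≤ 1) :
    Integrable F μ :=
  Integrable.of_bound hF.aestronglyMeasurable 1 (ae_of_all _ h)

/-- The direction of a Gaussian vector is distributed like a row of a uniform orthogonal
matrix. -/
theorem integral_rowAct_single {F : EuclideanSpace ℝ (Fin n) → ℝ} (hF : Measurable F)
    (hb : ∀ w, |F w| ≤ 1) (hc : ∀ c : ℝ, 0 < c → ∀ w, F (c • w) = F w) (i : Fin n) :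
    ∫ O, F (rowAct O (EuclideanSpace.single i 1)) ∂uniformOrthogonal n =
      ∫ g, F g ∂stdGaussian (EuclideanSpace ℝ (Fin n)) := by
  have h1 : ∀ᵐ g ∂stdGaussian (EuclideanSpace ℝ (Fin n)),
      ∫ O, F (rowAct O g) ∂uniformOrthogonal n =
        ∫ O, F (rowAct O (EuclideanSpace.single i 1)) ∂uniformOrthogonal n := by
    filter_upwards [stdGaussian_ne_zero i.pos] with g hg
    obtain ⟨Q, hQ⟩ := exists_rowAct_single (e := ‖g‖⁻¹ • g) (norm_smul_inv_norm hg) i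
    have h2 : ∀ O, F (rowAct O g) = F (rowAct (Q * O) (EuclideanSpace.single i 1)) := fun O => by
      rw [rowAct_mul, hQ, rowAct_smul, hc _ (inv_pos.2 (norm_pos_iff.2 hg))]
    simp only [h2]
    exact integral_rowAct_mul (F := fun O => F (rowAct O (EuclideanSpace.single i 1))) Q
  have h2 := integral_congr_ae h1
  rw [integral_const, probReal_univ, one_smul] at h2
  -- Average over both `O` and `g`: for fixed `g` the value does not depend on `g`, and for fixed
  -- `O` the Gaussian law absorbs the rotation.
  rw [← h2, integral_integral_swap]
  · simp [integral_stdGaussian_rowAct]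
  · exact integrable_of_abs_le_one (hF.comp (measurable_rowAct_uncurry.comp measurable_swap))
      fun _ => hb _

/-- The indicator of a hyperplane is scale invariant, so the Gaussian null set transfers to rows of
`O`. -/
theorem uniformOrthogonal_hyperplane {x : EuclideanSpace ℝ (Fin n)} (hx : x ≠ 0) (i : Fin n) :
    ∀ᵐ O ∂uniformOrthogonal n, inner ℝ (rowAct O (EuclideanSpace.single i 1)) x ≠ 0 := by
  have hS : MeasurableSet {w : EuclideanSpace ℝ (Fin n) | inner ℝ w x = 0} :=
    measurableSet_eq_fun (by fun_prop) measurable_const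
  have h := integral_rowAct_single
    (F := Set.indicator {w : EuclideanSpace ℝ (Fin n) | inner ℝ w x = 0} 1)
    (measurable_one.indicator hS)
    (fun w => by
      by_cases hw : w ∈ {w : EuclideanSpace ℝ (Fin n) | inner ℝ w x = 0} <;> simp [hw])
    (fun c hc w => by simp [Set.indicator, inner_smul_left, hc.ne']) i
  rw [integral_eq_zero_of_ae (μ := stdGaussian _), integral_eq_zero_iff_of_nonneg] at h
  · filter_upwards [h] with O hO h0
    simp [h0] at hO
  · exact fun O => Set.indicator_nonneg (fun _ _ => zero_le_one) _
  · refine integrable_of_abs_le_one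
      ((measurable_one.indicator hS).comp (measurable_rowAct_left _)) fun O => ?_
    by_cases hw : rowAct O (EuclideanSpace.single i 1) ∈
      {w : EuclideanSpace ℝ (Fin n) | inner ℝ w x = 0} <;> simp [hw]
  · filter_upwards [stdGaussian_hyperplane hx] with g hg
    simp [hg]

end rotate

/-! ### Sign products and Grothendieck's identity. -/

section signProd

variable {n : ℕ}

/-- The product of the signs of a vector against two test vectors. -/
noncomputable def signProd (x y w : EuclideanSpace ℝ (Fin n)) : ℝ :=
  sgn (inner ℝ w x) * sgn (inner ℝ w y)

theorem measurable_signProd (x y : EuclideanSpace ℝ (Fin n)) : Measurable (signProd x y) :=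
  (measurable_sgn.comp (by fun_prop)).mul (measurable_sgn.comp (by fun_prop))

theorem abs_signProd (x y w : EuclideanSpace ℝ (Fin n)) : |signProd x y w| = 1 := by
  rw [signProd, abs_mul, abs_sgn, abs_sgn, one_mul]

theorem signProd_mul_self (x y w : EuclideanSpace ℝ (Fin n)) :
    signProd x y w * signProd x y w = 1 := by
  rw [signProd, mul_mul_mul_comm, sgn_mul_self, sgn_mul_self, one_mul]

theorem signProd_smul (x y w : EuclideanSpace ℝ (Fin n)) {c : ℝ} (hc : 0 < c) :
    signProd x y (c • w) = signProd x y w := by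
  simp only [signProd, real_inner_smul_left, sgn_pos_mul hc]

/-- The averaging device: an expectation that does not depend on `φ` can be computed by first
integrating over `φ` at fixed `ω`. -/
theorem integral_average_period {Ω : Type*} [MeasurableSpace Ω] {μ : Measure Ω}
    [IsProbabilityMeasure μ] {f : ℝ → Ω → ℝ} (hf : Measurable (Function.uncurry f))
    (hb : ∀ φ ω, |f φ ω| ≤ 1) {c : ℝ} (h : ∀ φ, ∫ ω, f φ ω ∂μ = c) :
    ∫ ω, (∫ φ in (0 : ℝ)..(2 * Real.pi), f φ ω) ∂μ = 2 * Real.pi * c := by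
  have hpi : (0 : ℝ) ≤ 2 * Real.pi := by positivity
  simp only [intervalIntegral.integral_of_le hpi]
  rw [integral_integral_swap]
  · simp [h, hpi]
  · exact integrable_of_abs_le_one (hf.comp measurable_swap) fun _ => hb _ _

theorem integral_stdGaussian_pair (F : ℝ → ℝ → ℝ)
    {e f : EuclideanSpace ℝ (Fin n)} (he : ‖e‖ = 1) (hf : ‖f‖ = 1) (hef : inner ℝ e f = 0)
    {i j : Fin n} (hij : i ≠ j) :
    ∫ g, F (inner ℝ g e) (inner ℝ g f) ∂stdGaussian (EuclideanSpace ℝ (Fin n)) =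
      ∫ g, F (inner ℝ g (EuclideanSpace.single i 1)) (inner ℝ g (EuclideanSpace.single j 1))
        ∂stdGaussian (EuclideanSpace ℝ (Fin n)) := by
  obtain ⟨Q, rfl, rfl⟩ := exists_rowAct_pair he hf hef hij
  rw [← integral_stdGaussian_rowAct _ Q]
  simp only [inner_rowAct]

theorem norm_cos_smul_add_sin_smul {e f : EuclideanSpace ℝ (Fin n)} (he : ‖e‖ = 1)
    (hf : ‖f‖ = 1) (hef : inner ℝ e f = 0) (φ : ℝ) :
    ‖Real.cos φ • e + Real.sin φ • f‖ = 1 := by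
  have : ‖Real.cos φ • e + Real.sin φ • f‖ ^ 2 = 1 := by
    rw [norm_add_sq_real, norm_smul, norm_smul, inner_smul_left, inner_smul_right, hef, he, hf]
    simp
  exact (pow_eq_one_iff_of_nonneg (norm_nonneg _) two_ne_zero).1 this

theorem inner_rotate_eq_zero {e f : EuclideanSpace ℝ (Fin n)} (he : ‖e‖ = 1)
    (hf : ‖f‖ = 1) (hef : inner ℝ e f = 0) (φ : ℝ) :
    inner ℝ (Real.cos φ • e + Real.sin φ • f) (-Real.sin φ • e + Real.cos φ • f) = 0 := by
  have hfe : inner ℝ f e = 0 := by rw [real_inner_comm, hef]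
  simp only [inner_add_left, inner_add_right, real_inner_smul_left, real_inner_smul_right,
    real_inner_self_eq_norm_sq, he, hf, hef, hfe]
  ring

theorem norm_neg_sin_smul_add_cos_smul {e f : EuclideanSpace ℝ (Fin n)} (he : ‖e‖ = 1)
    (hf : ‖f‖ = 1) (hef : inner ℝ e f = 0) (φ : ℝ) :
    ‖-Real.sin φ • e + Real.cos φ • f‖ = 1 := by
  have := norm_cos_smul_add_sin_smul he hf hef (φ + Real.pi / 2)
  rwa [Real.cos_add_pi_div_two, Real.sin_add_pi_div_two] at this

/-- A vector in the plane spanned by an orthonormal pair, turned by the angle `φ`. -/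
theorem rotate_rotate (e f : EuclideanSpace ℝ (Fin n)) (φ γ : ℝ) :
    Real.cos (φ + γ) • e + Real.sin (φ + γ) • f =
      Real.cos γ • (Real.cos φ • e + Real.sin φ • f) +
        Real.sin γ • (-Real.sin φ • e + Real.cos φ • f) := by
  rw [Real.cos_add, Real.sin_add]
  module

/-- Decompose a unit vector along a unit vector `e` and a unit vector orthogonal to `e`. -/
theorem exists_unit_decomposition_of_sin_ne_zero {e w : EuclideanSpace ℝ (Fin n)} (he : ‖e‖ = 1)
    (hw : ‖w‖ = 1) (h : Real.sin (InnerProductGeometry.angle e w) ≠ 0) :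
    ∃ f, ‖f‖ = 1 ∧ inner ℝ e f = 0 ∧
      w = Real.cos (InnerProductGeometry.angle e w) • e +
        Real.sin (InnerProductGeometry.angle e w) • f := by
  set γ := InnerProductGeometry.angle e w
  have hc : inner ℝ e w = Real.cos γ := by
    rw [InnerProductGeometry.cos_angle, he, hw]; simp
  have hr : ‖w - Real.cos γ • e‖ ^ 2 = Real.sin γ ^ 2 := by
    rw [norm_sub_sq_real, norm_smul, real_inner_smul_right, real_inner_comm, hc, he, hw,
      Real.sin_sq, Real.norm_eq_abs, mul_one, sq_abs]
    ring
  have hs : 0 ≤ Real.sin γ := InnerProductGeometry.sin_angle_nonneg e w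
  have hr' : ‖w - Real.cos γ • e‖ = Real.sin γ := (sq_eq_sq₀ (norm_nonneg _) hs).1 hr
  refine ⟨(Real.sin γ)⁻¹ • (w - Real.cos γ • e), ?_, ?_, ?_⟩
  · rw [norm_smul, hr', Real.norm_eq_abs, abs_of_nonneg (inv_nonneg.2 hs), inv_mul_cancel₀ h]
  · rw [real_inner_smul_right, inner_sub_right, real_inner_smul_right,
      real_inner_self_eq_norm_sq, he, hc]
    ring
  · rw [smul_inv_smul₀ h]; abel

/-- Decompose a unit vector along a unit vector `e` and a unit vector orthogonal to `e`, where
`e'` witnesses that there is one. -/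
theorem exists_unit_decomposition {e e' w : EuclideanSpace ℝ (Fin n)} (he : ‖e‖ = 1)
    (he' : ‖e'‖ = 1) (hee' : inner ℝ e e' = 0) (hw : ‖w‖ = 1) :
    ∃ f, ‖f‖ = 1 ∧ inner ℝ e f = 0 ∧
      w = Real.cos (InnerProductGeometry.angle e w) • e +
        Real.sin (InnerProductGeometry.angle e w) • f := by
  by_cases h : Real.sin (InnerProductGeometry.angle e w) = 0
  · refine ⟨e', he', hee', ?_⟩
    rw [h, zero_smul, add_zero]
    rcases InnerProductGeometry.sin_eq_zero_iff_angle_eq_zero_or_angle_eq_pi.1 h with h' | h'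
    · rw [h', Real.cos_zero, one_smul]
      rw [InnerProductGeometry.angle_eq_zero_iff] at h'
      obtain ⟨-, r, hr, rfl⟩ := h'
      rw [norm_smul, he, mul_one, Real.norm_eq_abs, abs_of_pos hr] at hw
      rw [hw, one_smul]
    · rw [h', Real.cos_pi]
      rw [InnerProductGeometry.angle_eq_pi_iff] at h'
      obtain ⟨-, r, hr, rfl⟩ := h'
      rw [norm_smul, he, mul_one, Real.norm_eq_abs, abs_of_neg hr] at hw
      rw [← hw, neg_neg]
  · exact exists_unit_decomposition_of_sin_ne_zero he hw h

/-- The expected sign product of a Gaussian vector is the angular kernel, for unit vectors in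
the plane of a given orthonormal pair. -/
theorem integral_signProd_stdGaussian_of_unit {e f : EuclideanSpace ℝ (Fin n)} (he : ‖e‖ = 1)
    (hf : ‖f‖ = 1) (hef : inner ℝ e f = 0) {i j : Fin n} (hij : i ≠ j) {θ : ℝ} (h₀ : 0 ≤ θ)
    (hθ : θ ≤ Real.pi) :
    ∫ g, signProd e (Real.cos θ • e + Real.sin θ • f) g
      ∂stdGaussian (EuclideanSpace ℝ (Fin n)) = 1 - 2 * θ / Real.pi := by
  -- Turning both vectors by `φ` in their plane preserves the expectation.
  have h1 : ∀ φ, ∫ g, signProd (Real.cos φ • e + Real.sin φ • f)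
      (Real.cos (φ + θ) • e + Real.sin (φ + θ) • f) g ∂stdGaussian (EuclideanSpace ℝ (Fin n)) =
      ∫ g, signProd e (Real.cos θ • e + Real.sin θ • f) g
        ∂stdGaussian (EuclideanSpace ℝ (Fin n)) := fun φ => by
    simp only [rotate_rotate, signProd, inner_add_right _ (Real.cos θ • _),
      real_inner_smul_right _ _ (Real.cos θ), real_inner_smul_right _ _ (Real.sin θ)]
    have := fun e f he hf hef => integral_stdGaussian_pair (n := n)
      (fun a b => sgn a * sgn (Real.cos θ * a + Real.sin θ * b)) (e := e) (f := f) he hf hef hij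
    rw [this _ _ he hf hef, this _ _ (norm_cos_smul_add_sin_smul he hf hef φ)
      (norm_neg_sin_smul_add_cos_smul he hf hef φ) (inner_rotate_eq_zero he hf hef φ)]
  have h2 := integral_average_period (μ := stdGaussian (EuclideanSpace ℝ (Fin n)))
    (f := fun φ g => signProd (Real.cos φ • e + Real.sin φ • f)
      (Real.cos (φ + θ) • e + Real.sin (φ + θ) • f) g)
    ((measurable_sgn.comp (by fun_prop)).mul (measurable_sgn.comp (by fun_prop)))
    (fun φ g => (abs_signProd _ _ _).le) h1
  -- For fixed `g` the two signs are square waves in `φ` with phases `θ` apart, so the integral is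
  -- `waveCorr θ`, the same for almost every `g`.
  have h3 : ∀ᵐ g ∂stdGaussian (EuclideanSpace ℝ (Fin n)),
      ∫ φ in (0 : ℝ)..(2 * Real.pi), signProd (Real.cos φ • e + Real.sin φ • f)
        (Real.cos (φ + θ) • e + Real.sin (φ + θ) • f) g = 2 * Real.pi - 4 * θ := by
    have he0 : e ≠ 0 := by rw [← norm_ne_zero_iff, he]; exact one_ne_zero
    filter_upwards [stdGaussian_hyperplane he0] with g hg
    obtain ⟨α, hα⟩ := exists_sgn_rotate_eq (b := inner ℝ g f) (Or.inl hg)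
    simp only [signProd, inner_add_right, real_inner_smul_right, hα,
      show ∀ φ, φ + θ - α = φ - (α - θ) from fun φ => by ring, integral_signWave_sub_mul]
    rw [show α - θ - α = -θ by ring, waveCorr_neg, waveCorr_of_mem h₀ hθ]
  rw [integral_congr_ae h3, integral_const, probReal_univ, one_smul] at h2
  have := Real.pi_pos
  field_simp
  linarith

theorem exists_ne_of_orthonormal_pair {e f : EuclideanSpace ℝ (Fin n)} (he : ‖e‖ = 1)
    (hf : ‖f‖ = 1) (hef : inner ℝ e f = 0) : ∃ i j : Fin n, i ≠ j := by
  have h : Orthonormal ℝ ![e, f] := by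
    rw [orthonormal_iff_ite]
    have hfe : inner ℝ f e = 0 := by rw [real_inner_comm, hef]
    intro a b
    fin_cases a <;> fin_cases b <;> simp [he, hf, hef, hfe]
  have hn := h.linearIndependent.fintype_card_le_finrank
  simp only [Fintype.card_fin, finrank_euclideanSpace] at hn
  exact ⟨⟨0, by lia⟩, ⟨1, by lia⟩, by simp⟩

/-- Grothendieck's identity: the expected sign product of a Gaussian vector. -/
theorem integral_signProd_stdGaussian {x y : EuclideanSpace ℝ (Fin n)} (hx : x ≠ 0) (hy : y ≠ 0) :
    ∫ g, signProd x y g ∂stdGaussian (EuclideanSpace ℝ (Fin n)) = angularKernel x y := by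
  rw [angularKernel]
  by_cases h₀ : InnerProductGeometry.angle x y = 0
  · obtain ⟨-, r, hr, rfl⟩ := InnerProductGeometry.angle_eq_zero_iff.1 h₀
    simp [h₀, signProd, real_inner_smul_right, sgn_pos_mul hr, sgn_mul_self]
  by_cases hπ : InnerProductGeometry.angle x y = Real.pi
  · obtain ⟨-, r, hr, rfl⟩ := InnerProductGeometry.angle_eq_pi_iff.1 hπ
    -- Only almost surely: on the hyperplane orthogonal to `x` both signs are `-1` and the product
    -- is `1`.
    have : ∀ᵐ g ∂stdGaussian (EuclideanSpace ℝ (Fin n)), signProd x (r • x) g = -1 := by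
      filter_upwards [stdGaussian_hyperplane hx] with g hg
      rw [signProd, real_inner_smul_right, sgn_mul hr.ne hg, sgn_of_nonpos hr.le, neg_one_mul,
        mul_neg, sgn_mul_self]
    rw [integral_congr_ae this, hπ]
    have := Real.pi_ne_zero
    simp
    field_simp
    norm_num
  have hx' : 0 < ‖x‖⁻¹ := inv_pos.2 (norm_pos_iff.2 hx)
  have hy' : 0 < ‖y‖⁻¹ := inv_pos.2 (norm_pos_iff.2 hy)
  have hangle : InnerProductGeometry.angle (‖x‖⁻¹ • x) (‖y‖⁻¹ • y) =
      InnerProductGeometry.angle x y := by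
    rw [InnerProductGeometry.angle_smul_left_of_pos _ _ hx',
      InnerProductGeometry.angle_smul_right_of_pos _ _ hy']
  have hxn : ‖‖x‖⁻¹ • x‖ = 1 := norm_smul_inv_norm hx
  have hyn : ‖‖y‖⁻¹ • y‖ = 1 := norm_smul_inv_norm hy
  obtain ⟨f, hf, hef, hw⟩ := exists_unit_decomposition_of_sin_ne_zero
    (e := ‖x‖⁻¹ • x) (w := ‖y‖⁻¹ • y) hxn hyn fun h => by
      rw [hangle, InnerProductGeometry.sin_eq_zero_iff_angle_eq_zero_or_angle_eq_pi] at h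
      exact h.elim h₀ hπ
  obtain ⟨i, j, hij⟩ := exists_ne_of_orthonormal_pair hxn hf hef
  have := integral_signProd_stdGaussian_of_unit hxn hf hef hij
    (InnerProductGeometry.angle_nonneg x y) (InnerProductGeometry.angle_le_pi x y)
  rw [hangle] at hw
  rw [← this]
  refine integral_congr_ae (ae_of_all _ fun g => ?_)
  rw [← hw, signProd, signProd, real_inner_smul_right, real_inner_smul_right, sgn_pos_mul hx',
    sgn_pos_mul hy']

end signProd

/-! ### Correlation of two rows of a Haar orthogonal matrix. -/

section covariance

variable {n : ℕ}

/-- The correlation of the sign products of the `i`-th row of a uniform orthogonal matrix `O` and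
of `wᵀ O`. -/
noncomputable def signCorr (x y : EuclideanSpace ℝ (Fin n)) (i : Fin n)
    (w : EuclideanSpace ℝ (Fin n)) : ℝ :=
  ∫ O, signProd x y (rowAct O (EuclideanSpace.single i 1)) * signProd x y (rowAct O w)
    ∂uniformOrthogonal n

theorem abs_signProd_mul_le (x y v w : EuclideanSpace ℝ (Fin n)) :
    |signProd x y v * signProd x y w| ≤ 1 := by
  rw [abs_mul, abs_signProd, abs_signProd, one_mul]

theorem integral_signProd_row {x y : EuclideanSpace ℝ (Fin n)} (hx : x ≠ 0) (hy : y ≠ 0)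
    (i : Fin n) :
    ∫ O, signProd x y (rowAct O (EuclideanSpace.single i 1)) ∂uniformOrthogonal n =
      angularKernel x y := by
  rw [integral_rowAct_single (measurable_signProd x y) (fun w => (abs_signProd x y w).le)
    (fun c hc w => signProd_smul x y w hc) i, integral_signProd_stdGaussian hx hy]

theorem Measurable.rowAct {α : Type*} [MeasurableSpace α]
    {O : α → Matrix.orthogonalGroup (Fin n) ℝ} {w : α → EuclideanSpace ℝ (Fin n)}
    (hO : Measurable O) (hw : Measurable w) : Measurable fun a => rowAct (O a) (w a) :=
  measurable_rowAct_uncurry.comp (hO.prodMk hw)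

theorem norm_single_one (i : Fin n) : 
    ‖(EuclideanSpace.single i 1 : EuclideanSpace ℝ (Fin n))‖ = 1 := by
  simp

theorem inner_single_single_of_ne {i j : Fin n} (hij : i ≠ j) :
    inner ℝ (EuclideanSpace.single i 1 : EuclideanSpace ℝ (Fin n))
      (EuclideanSpace.single j 1) = 0 := by
  rw [EuclideanSpace.inner_single_left]
  simp [hij]

/-- Averaging over a second, independent uniform orthogonal matrix decorrelates the rows. -/
theorem integral_signCorr {x y : EuclideanSpace ℝ (Fin n)} (hx : x ≠ 0) (hy : y ≠ 0)
    (i : Fin n) :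
    ∫ O', signCorr x y i (rowAct O' (EuclideanSpace.single i 1)) ∂uniformOrthogonal n =
      angularKernel x y ^ 2 := by
  unfold signCorr
  rw [integral_integral_swap]
  -- For fixed `O`, the random row of `O'` may be replaced by a Gaussian vector, whose law is
  -- unchanged by `O`; the second factor then averages to `K`.
  · have h : ∀ O, ∫ O', signProd x y (rowAct O (EuclideanSpace.single i 1)) *
        signProd x y (rowAct O (rowAct O' (EuclideanSpace.single i 1))) ∂uniformOrthogonal n =
        signProd x y (rowAct O (EuclideanSpace.single i 1)) * angularKernel x y := fun O => by
      rw [integral_const_mul, integral_rowAct_single (F := fun w => signProd x y (rowAct O w))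
        ((measurable_signProd x y).comp (Measurable.rowAct measurable_const measurable_id))
        (fun w => (abs_signProd x y _).le)
        (fun c hc w => by rw [rowAct_smul, signProd_smul x y _ hc]) i,
        integral_stdGaussian_rowAct, integral_signProd_stdGaussian hx hy]
    simp only [h]
    rw [integral_mul_const, integral_signProd_row hx hy, sq]
  · refine integrable_of_abs_le_one ?_ fun _ => abs_signProd_mul_le _ _ _ _
    exact ((measurable_signProd x y).comp
      (Measurable.rowAct measurable_snd measurable_const)).mul
      ((measurable_signProd x y).comp (Measurable.rowAct measurable_snd
        (Measurable.rowAct measurable_fst measurable_const)))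

/-- The correlation with a vector at angle `γ`, averaged over the rotations of the plane. -/
theorem signCorr_eq_integral (x y : EuclideanSpace ℝ (Fin n)) {i j : Fin n} (hij : i ≠ j) (γ : ℝ) :
    ∫ O, (∫ φ in (0 : ℝ)..(2 * Real.pi),
      signProd x y (Real.cos φ • rowAct O (EuclideanSpace.single i 1) +
        Real.sin φ • rowAct O (EuclideanSpace.single j 1)) *
      signProd x y (Real.cos (φ + γ) • rowAct O (EuclideanSpace.single i 1) +
        Real.sin (φ + γ) • rowAct O (EuclideanSpace.single j 1))) ∂uniformOrthogonal n =
    2 * Real.pi * signCorr x y i (Real.cos γ • EuclideanSpace.single i 1 +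
      Real.sin γ • EuclideanSpace.single j 1) := by
  refine integral_average_period ?_ (fun φ O => abs_signProd_mul_le _ _ _ _) fun φ => ?_
  · have h1 := fun k : Fin n => Measurable.rowAct
      (O := fun p : ℝ × Matrix.orthogonalGroup (Fin n) ℝ => p.2) measurable_snd
      (measurable_const (a := EuclideanSpace.single k (1 : ℝ)))
    have h2 := h1 i
    have h3 := h1 j
    exact ((measurable_signProd x y).comp (by fun_prop)).mul
      ((measurable_signProd x y).comp (by fun_prop))
  · have := integral_rowAct_pair (n := n)
      (fun u v => signProd x y u * signProd x y (Real.cos γ • u + Real.sin γ • v))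
      (norm_cos_smul_add_sin_smul (norm_single_one i) (norm_single_one j)
        (inner_single_single_of_ne hij) φ)
      (norm_neg_sin_smul_add_cos_smul (norm_single_one i) (norm_single_one j)
        (inner_single_single_of_ne hij) φ)
      (inner_rotate_eq_zero (norm_single_one i) (norm_single_one j)
        (inner_single_single_of_ne hij) φ) hij
    simp only [← rowAct_smul, ← rowAct_add, rotate_rotate] at this ⊢
    exact this

/-- Only the angle matters: Haar invariance moves the component of `w` orthogonal to `eᵢ` onto `eⱼ`.
If `w = ±eᵢ`, `eⱼ` serves as the orthogonal direction. -/
theorem signCorr_eq_of_unit (x y : EuclideanSpace ℝ (Fin n)) {i j : Fin n} (hij : i ≠ j)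
    {w : EuclideanSpace ℝ (Fin n)} (hw : ‖w‖ = 1) :
    ∃ γ, γ = InnerProductGeometry.angle (EuclideanSpace.single i 1) w ∧
      signCorr x y i w = signCorr x y i (Real.cos γ • EuclideanSpace.single i 1 +
        Real.sin γ • EuclideanSpace.single j 1) := by
  obtain ⟨f, hf, hef, h⟩ := exists_unit_decomposition (norm_single_one i) (norm_single_one j)
    (inner_single_single_of_ne hij) hw
  refine ⟨_, rfl, ?_⟩
  generalize InnerProductGeometry.angle (EuclideanSpace.single i 1) w = γ at h
  rw [h]
  simp only [signCorr, rowAct_add, rowAct_smul]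
  exact integral_rowAct_pair
    (fun u v => signProd x y u * signProd x y (Real.cos γ • u + Real.sin γ • v))
    (norm_single_one i) hf hef hij

/-- The phases `α, β` are the polar angles of the projections of `x, y` to the plane of the two
rows. They are chosen before `γ`, so different shifts can be compared for the same `O`. -/
theorem ae_exists_waveCorr₄ {x y : EuclideanSpace ℝ (Fin n)} (hx : x ≠ 0) (hy : y ≠ 0)
    (i j : Fin n) :
    ∀ᵐ O ∂uniformOrthogonal n, ∃ α β, ∀ γ, (∫ φ in (0 : ℝ)..(2 * Real.pi),
      signProd x y (Real.cos φ • rowAct O (EuclideanSpace.single i 1) +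
        Real.sin φ • rowAct O (EuclideanSpace.single j 1)) *
      signProd x y (Real.cos (φ + γ) • rowAct O (EuclideanSpace.single i 1) +
        Real.sin (φ + γ) • rowAct O (EuclideanSpace.single j 1))) = waveCorr₄ α β γ := by
  filter_upwards [uniformOrthogonal_hyperplane hx i, uniformOrthogonal_hyperplane hy i] with O h h'
  obtain ⟨α, hα⟩ := exists_sgn_rotate_eq
    (b := inner ℝ (rowAct O (EuclideanSpace.single j 1)) x) (Or.inl h)
  obtain ⟨β, hβ⟩ := exists_sgn_rotate_eq
    (b := inner ℝ (rowAct O (EuclideanSpace.single j 1)) y) (Or.inl h')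
  refine ⟨α, β, fun γ => ?_⟩
  simp only [signProd, inner_add_left, real_inner_smul_left, hα, hβ, waveCorr₄]

theorem integrable_average (x y : EuclideanSpace ℝ (Fin n)) (i j : Fin n) (γ : ℝ) :
    Integrable (fun O => ∫ φ in (0 : ℝ)..(2 * Real.pi),
      signProd x y (Real.cos φ • rowAct O (EuclideanSpace.single i 1) +
        Real.sin φ • rowAct O (EuclideanSpace.single j 1)) *
      signProd x y (Real.cos (φ + γ) • rowAct O (EuclideanSpace.single i 1) +
        Real.sin (φ + γ) • rowAct O (EuclideanSpace.single j 1))) (uniformOrthogonal n) := by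
  simp only [intervalIntegral.integral_of_le Real.two_pi_pos.le]
  refine Integrable.integral_prod_left (f := fun p : Matrix.orthogonalGroup (Fin n) ℝ × ℝ =>
      signProd x y (Real.cos p.2 • rowAct p.1 (EuclideanSpace.single i 1) +
        Real.sin p.2 • rowAct p.1 (EuclideanSpace.single j 1)) *
      signProd x y (Real.cos (p.2 + γ) • rowAct p.1 (EuclideanSpace.single i 1) +
        Real.sin (p.2 + γ) • rowAct p.1 (EuclideanSpace.single j 1))) ?_
  refine integrable_of_abs_le_one ?_ fun _ => abs_signProd_mul_le _ _ _ _
  have h1 := fun k : Fin n => Measurable.rowAct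
      (O := fun p : Matrix.orthogonalGroup (Fin n) ℝ × ℝ => p.1) measurable_fst
      (measurable_const (a := EuclideanSpace.single k (1 : ℝ)))
  have h2 := h1 i
  have h3 := h1 j
  exact ((measurable_signProd x y).comp (by fun_prop)).mul
      ((measurable_signProd x y).comp (by fun_prop))

/-- Among all unit vectors, those orthogonal to `eᵢ` correlate the least with it. -/
theorem signCorr_orthogonal_le {x y : EuclideanSpace ℝ (Fin n)} (hx : x ≠ 0) (hy : y ≠ 0)
    {i j : Fin n} (hij : i ≠ j) {w : EuclideanSpace ℝ (Fin n)} (hw : ‖w‖ = 1) :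
    signCorr x y i (EuclideanSpace.single j 1) ≤ signCorr x y i w := by
  obtain ⟨γ, -, h⟩ := signCorr_eq_of_unit x y hij hw
  rw [h]
  have h1 := signCorr_eq_integral x y hij (Real.pi / 2)
  rw [Real.cos_pi_div_two, Real.sin_pi_div_two, zero_smul, zero_add, one_smul] at h1
  refine le_of_mul_le_mul_left ?_ Real.two_pi_pos
  rw [← h1, ← signCorr_eq_integral x y hij γ]
  refine integral_mono_ae (integrable_average x y i j _) (integrable_average x y i j _) ?_
  filter_upwards [ae_exists_waveCorr₄ hx hy i j] with O hO
  obtain ⟨α, β, hO⟩ := hO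
  rw [hO, hO]
  exact waveCorr₄_quarter_le α β γ

/-- Comes from `le_waveCorr₄_shift`, since `2 * waveCorr γ - 2π = 2π - 8γ`. It quantifies that the
correlation tends to `1` as `w` approaches `eᵢ`. -/
theorem le_signCorr {x y : EuclideanSpace ℝ (Fin n)} (hx : x ≠ 0) (hy : y ≠ 0)
    {i j : Fin n} (hij : i ≠ j) {w : EuclideanSpace ℝ (Fin n)} (hw : ‖w‖ = 1) :
    1 - 4 * InnerProductGeometry.angle (EuclideanSpace.single i 1) w / Real.pi ≤
      signCorr x y i w := by
  obtain ⟨γ, hγ, h⟩ := signCorr_eq_of_unit x y hij hw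
  rw [h, ← hγ]
  refine le_of_mul_le_mul_left ?_ Real.two_pi_pos
  rw [← signCorr_eq_integral x y hij γ]
  have h1 : 2 * Real.pi * (1 - 4 * γ / Real.pi) = 2 * Real.pi - 8 * γ := by
    have := Real.pi_ne_zero
    field_simp
    ring
  have h2 : 2 * Real.pi - 8 * γ = ∫ _, (2 * Real.pi - 8 * γ) ∂uniformOrthogonal n := by simp
  rw [h1, h2]
  refine integral_mono_ae (integrable_const _) (integrable_average x y i j _) ?_
  filter_upwards [ae_exists_waveCorr₄ hx hy i j] with O hO
  obtain ⟨α, β, hO⟩ := hO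
  rw [hO]
  have h3 := le_waveCorr₄_shift α β γ
  rw [waveCorr_of_mem (hγ ▸ InnerProductGeometry.angle_nonneg _ _)
    (hγ ▸ InnerProductGeometry.angle_le_pi _ _)] at h3
  linarith

/-! ### Strictness: open conditions on `O` have positive Haar measure. -/

theorem isOpen_inner_rowAct_pos (e x : EuclideanSpace ℝ (Fin n)) :
    IsOpen {O : Matrix.orthogonalGroup (Fin n) ℝ | 0 < inner ℝ (rowAct O e) x} :=
  isOpen_lt continuous_const ((continuous_rowAct_left e).inner continuous_const)

/-- Take the bisectors `‖y‖x ± ‖x‖y`: they are orthogonal, and strict Cauchy–Schwarz gives the four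
signs. Writing `-y` makes every condition a strict positivity, hence open. -/
theorem exists_orthogonal_separating {x y : EuclideanSpace ℝ (Fin n)}
    (h : |inner ℝ x y| < ‖x‖ * ‖y‖) {i j : Fin n} (hij : i ≠ j) :
    ∃ O : Matrix.orthogonalGroup (Fin n) ℝ,
      0 < inner ℝ (rowAct O (EuclideanSpace.single i 1)) x ∧
      0 < inner ℝ (rowAct O (EuclideanSpace.single i 1)) y ∧
      0 < inner ℝ (rowAct O (EuclideanSpace.single j 1)) x ∧
      0 < inner ℝ (rowAct O (EuclideanSpace.single j 1)) (-y) := by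
  obtain ⟨h1, h2⟩ := abs_lt.1 h
  have hprod : 0 < ‖x‖ * ‖y‖ := (abs_nonneg _).trans_lt h
  have hx : 0 < ‖x‖ := pos_of_mul_pos_left hprod (norm_nonneg _)
  have hy : 0 < ‖y‖ := pos_of_mul_pos_right hprod (norm_nonneg _)
  set p := ‖y‖ • x + ‖x‖ • y
  set q := ‖y‖ • x - ‖x‖ • y
  have hyx : inner ℝ y x = inner ℝ x y := real_inner_comm _ _
  have hpq : inner ℝ p q = 0 := by
    simp only [p, q, inner_add_left, inner_sub_right, real_inner_smul_left, real_inner_smul_right,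
      real_inner_self_eq_norm_sq x, real_inner_self_eq_norm_sq y, hyx]
    ring
  have hpx : 0 < inner ℝ p x := by
    simp only [p, inner_add_left, real_inner_smul_left, real_inner_self_eq_norm_sq, hyx]
    nlinarith
  have hpy : 0 < inner ℝ p y := by
    simp only [p, inner_add_left, real_inner_smul_left, real_inner_self_eq_norm_sq]
    nlinarith
  have hqx : 0 < inner ℝ q x := by
    simp only [q, inner_sub_left, real_inner_smul_left, real_inner_self_eq_norm_sq, hyx]
    nlinarith
  have hqy : 0 < inner ℝ q (-y) := by
    simp only [q, inner_sub_left, inner_neg_right, real_inner_smul_left,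
      real_inner_self_eq_norm_sq]
    nlinarith
  have hp0 : p ≠ 0 := fun h0 => by simp [h0] at hpx
  have hq0 : q ≠ 0 := fun h0 => by simp [h0] at hqx
  have hp' : 0 < ‖p‖⁻¹ := inv_pos.2 (norm_pos_iff.2 hp0)
  have hq' : 0 < ‖q‖⁻¹ := inv_pos.2 (norm_pos_iff.2 hq0)
  obtain ⟨O, hOp, hOq⟩ := exists_rowAct_pair (e := ‖p‖⁻¹ • p) (f := ‖q‖⁻¹ • q)
    (norm_smul_inv_norm hp0) (norm_smul_inv_norm hq0)
    (by rw [real_inner_smul_left, real_inner_smul_right, hpq, mul_zero, mul_zero]) hij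
  refine ⟨O, ?_, ?_, ?_, ?_⟩
  · rw [hOp, real_inner_smul_left]; exact mul_pos hp' hpx
  · rw [hOp, real_inner_smul_left]; exact mul_pos hp' hpy
  · rw [hOq, real_inner_smul_left]; exact mul_pos hq' hqx
  · rw [hOq, real_inner_smul_left]; exact mul_pos hq' hqy

theorem measurable_signProd_rowAct (x y e : EuclideanSpace ℝ (Fin n)) :
    Measurable fun O => signProd x y (rowAct O e) :=
  (measurable_signProd x y).comp (measurable_rowAct_left e)

/-- Near the matrix built from the bisectors the two sign products are `1` and `-1`, so their
product is `-1` with positive probability. -/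
theorem signCorr_orthogonal_lt_one {x y : EuclideanSpace ℝ (Fin n)}
    (h : |inner ℝ x y| < ‖x‖ * ‖y‖) {i j : Fin n} (hij : i ≠ j) :
    signCorr x y i (EuclideanSpace.single j 1) < 1 := by
  set F : Matrix.orthogonalGroup (Fin n) ℝ → ℝ := fun O =>
    signProd x y (rowAct O (EuclideanSpace.single i 1)) *
      signProd x y (rowAct O (EuclideanSpace.single j 1))
  have hint : Integrable F (uniformOrthogonal n) := integrable_of_abs_le_one
    ((measurable_signProd_rowAct x y _).mul (measurable_signProd_rowAct x y _))
    fun _ => abs_signProd_mul_le _ _ _ _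
  have hpos : 0 < ∫ O, (1 - F O) ∂uniformOrthogonal n := by
    rw [integral_pos_iff_support_of_nonneg
      (fun O => sub_nonneg.2 ((abs_le.1 (abs_signProd_mul_le _ _ _ _)).2))
      ((integrable_const 1).sub hint)]
    have hopen := ((isOpen_inner_rowAct_pos (EuclideanSpace.single i 1) x).inter
      (isOpen_inner_rowAct_pos (EuclideanSpace.single i 1) y)).inter
      ((isOpen_inner_rowAct_pos (EuclideanSpace.single j 1) x).inter
      (isOpen_inner_rowAct_pos (EuclideanSpace.single j 1) (-y)))
    obtain ⟨O, h1, h2, h3, h4⟩ := exists_orthogonal_separating h hij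
    refine (hopen.measure_pos (uniformOrthogonal n) ⟨O, ⟨h1, h2⟩, h3, h4⟩).trans_le
      (measure_mono ?_)
    rintro O ⟨⟨h1, h2⟩, h3, h4⟩
    simp only [Set.mem_ofPred_eq, inner_neg_right, Left.neg_pos_iff] at h1 h2 h3 h4
    simp only [Function.mem_support, signProd, sgn_of_pos h1, sgn_of_pos h2, sgn_of_pos h3,
      sgn_of_nonpos h4.le]
    norm_num
  rw [integral_sub (integrable_const 1) hint] at hpos
  simpa [signCorr] using hpos

/-- Two rows of a uniform orthogonal matrix have negatively correlated sign products. -/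
theorem signCorr_orthogonal_lt {x y : EuclideanSpace ℝ (Fin n)} (hx : x ≠ 0) (hy : y ≠ 0)
    (h : |inner ℝ x y| < ‖x‖ * ‖y‖) {i j : Fin n} (hij : i ≠ j) :
    signCorr x y i (EuclideanSpace.single j 1) < angularKernel x y ^ 2 := by
  set c := signCorr x y i (EuclideanSpace.single j 1) with hc
  have hc1 : c < 1 := signCorr_orthogonal_lt_one h hij
  have hnorm : ∀ O : Matrix.orthogonalGroup (Fin n) ℝ,
      ‖rowAct O (EuclideanSpace.single i 1)‖ = 1 := fun O => by
    rw [norm_eq_sqrt_real_inner, inner_rowAct, ← norm_eq_sqrt_real_inner, norm_single_one]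
  have hint : Integrable (fun O => signCorr x y i (rowAct O (EuclideanSpace.single i 1)))
      (uniformOrthogonal n) := by
    unfold signCorr
    refine Integrable.integral_prod_left (f := fun p : Matrix.orthogonalGroup (Fin n) ℝ ×
      Matrix.orthogonalGroup (Fin n) ℝ => signProd x y (rowAct p.2 (EuclideanSpace.single i 1)) *
        signProd x y (rowAct p.2 (rowAct p.1 (EuclideanSpace.single i 1)))) ?_
    refine integrable_of_abs_le_one ?_ fun _ => abs_signProd_mul_le _ _ _ _
    exact ((measurable_signProd x y).comp
      (Measurable.rowAct measurable_snd measurable_const)).mul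
      ((measurable_signProd x y).comp (Measurable.rowAct measurable_snd
        (Measurable.rowAct measurable_fst measurable_const)))
  have hpos : 0 < ∫ O, (signCorr x y i (rowAct O (EuclideanSpace.single i 1)) - c)
      ∂uniformOrthogonal n := by
    rw [integral_pos_iff_support_of_nonneg
      (fun O => sub_nonneg.2 (signCorr_orthogonal_le hx hy hij (hnorm O)))
      (hint.sub (integrable_const c))]
    -- The threshold solves `1 - 4γ/π = c`; below it `le_signCorr` forces a value larger than `c`.
    -- The identity lies in `U`, at angle `0`.
    set U : Set (Matrix.orthogonalGroup (Fin n) ℝ) := {O | InnerProductGeometry.angle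
      (EuclideanSpace.single i 1) (rowAct O (EuclideanSpace.single i 1)) < Real.pi * (1 - c) / 4}
    have hU : IsOpen U := by
      refine isOpen_lt ?_ continuous_const
      unfold InnerProductGeometry.angle
      simp only [hnorm, norm_single_one, mul_one, div_one]
      exact Real.continuous_arccos.comp (continuous_const.inner (continuous_rowAct_left _))
    have h1 : (1 : Matrix.orthogonalGroup (Fin n) ℝ) ∈ U := by
      have : rowAct 1 (EuclideanSpace.single i 1 : EuclideanSpace ℝ (Fin n)) =
        EuclideanSpace.single i 1 := by simp [rowAct]
      change InnerProductGeometry.angle _ _ < _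
      rw [this, InnerProductGeometry.angle_self (by rw [← norm_ne_zero_iff]; simp)]
      have := Real.pi_pos
      have : 0 < 1 - c := by linarith
      positivity
    refine (hU.measure_pos (uniformOrthogonal n) ⟨1, h1⟩).trans_le (measure_mono fun O hO => ?_)
    have h2 := le_signCorr hx hy hij (hnorm O)
    have h3 : 4 * InnerProductGeometry.angle
      (EuclideanSpace.single i 1) (rowAct O (EuclideanSpace.single i 1)) / Real.pi < 1 - c := by
      rw [div_lt_iff₀ Real.pi_pos]
      have : InnerProductGeometry.angle (EuclideanSpace.single i 1)
        (rowAct O (EuclideanSpace.single i 1)) < Real.pi * (1 - c) / 4 := hO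
      linarith
    exact (by linarith : 0 < signCorr x y i (rowAct O (EuclideanSpace.single i 1)) - c).ne'
  rw [integral_sub hint (integrable_const c), integral_signCorr hx hy] at hpos
  simpa using hpos

end covariance

/-! ### Mean squared error as a sum of covariances. -/

section meanSquaredError

/-- The error is the average of the centred `s k - K`; expand its square and integrate termwise. -/
theorem integral_sq_average_sub {Ω : Type*} [MeasurableSpace Ω] {μ : Measure Ω}
    [IsProbabilityMeasure μ] {m : ℕ} (hm : m ≠ 0) {s : Fin m → Ω → ℝ}
    (hs : ∀ k, Measurable (s k)) (hb : ∀ k ω, |s k ω| ≤ 1) {K : ℝ}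
    (hK : ∀ k, ∫ ω, s k ω ∂μ = K) :
    ∫ ω, ((1 / (m : ℝ)) * (∑ k, s k ω) - K) ^ 2 ∂μ =
      (1 / (m : ℝ)) ^ 2 * ∑ k, ∑ l, ((∫ ω, s k ω * s l ω ∂μ) - K ^ 2) := by
  have hm' : (m : ℝ) ≠ 0 := Nat.cast_ne_zero.2 hm
  have hi : ∀ k, Integrable (s k) μ := fun k => integrable_of_abs_le_one (hs k) (hb k)
  have hii : ∀ k l, Integrable (fun ω => s k ω * s l ω) μ := fun k l =>
    integrable_of_abs_le_one ((hs k).mul (hs l)) fun ω => by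
      rw [abs_mul]; exact mul_le_one₀ (hb k ω) (abs_nonneg _) (hb l ω)
  have hexp : ∀ ω, ((1 / (m : ℝ)) * (∑ k, s k ω) - K) ^ 2 =
      (1 / (m : ℝ)) ^ 2 * ∑ k, ∑ l, (s k ω * s l ω - K * s k ω - K * s l ω + K ^ 2) := fun ω => by
    have h1 : (1 / (m : ℝ)) * (∑ k, s k ω) - K = (1 / (m : ℝ)) * ∑ k, (s k ω - K) := by
      rw [Finset.sum_sub_distrib, Finset.sum_const, Finset.card_univ, Fintype.card_fin,
        nsmul_eq_mul]
      field_simp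
    rw [h1, mul_pow, sq (∑ k, (s k ω - K)), Finset.sum_mul_sum]
    congr 1
    refine Finset.sum_congr rfl fun k _ => Finset.sum_congr rfl fun l _ => ?_
    ring
  have hi4 : ∀ k l, Integrable (fun ω => s k ω * s l ω - K * s k ω - K * s l ω + K ^ 2) μ :=
    fun k l => (((hii k l).sub ((hi k).const_mul K)).sub ((hi l).const_mul K)).add
      (integrable_const _)
  simp only [hexp]
  rw [integral_const_mul, integral_finsetSum _ fun k _ => integrable_finsetSum _ fun l _ => hi4 k l]
  congr 1
  refine Finset.sum_congr rfl fun k _ => ?_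
  rw [integral_finsetSum _ fun l _ => hi4 k l]
  refine Finset.sum_congr rfl fun l _ => ?_
  have h1 : Integrable (fun ω => s k ω * s l ω - K * s k ω) μ := (hii k l).sub ((hi k).const_mul K)
  have h2 : Integrable (fun ω => s k ω * s l ω - K * s k ω - K * s l ω) μ :=
    h1.sub ((hi l).const_mul K)
  rw [integral_add h2 (integrable_const _), integral_sub h1 ((hi l).const_mul K),
    integral_sub (hii k l) ((hi k).const_mul K), integral_const_mul, integral_const_mul, hK, hK]
  simp
  ring

variable {m n : ℕ}

/-- The sign product of the `k`-th row of a matrix. -/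
noncomputable def rowSign (x y : EuclideanSpace ℝ (Fin n)) (k : Fin m)
    (M : Matrix (Fin m) (Fin n) ℝ) : ℝ :=
  signProd x y (WithLp.toLp 2 (M k))

theorem measurable_rowSign (x y : EuclideanSpace ℝ (Fin n)) (k : Fin m) :
    Measurable (rowSign x y k) :=
  (measurable_signProd x y).comp ((WithLp.measurable_toLp 2 _).comp
    (measurable_pi_lambda _ fun j => measurable_matrix_apply k j))

theorem measurable_rowSign_mul (x y : EuclideanSpace ℝ (Fin n)) (k l : Fin m) :
    Measurable fun M => rowSign x y k M * rowSign x y l M :=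
  (measurable_rowSign x y k).mul (measurable_rowSign x y l)

theorem abs_rowSign_le (x y : EuclideanSpace ℝ (Fin n)) (k : Fin m)
    (M : Matrix (Fin m) (Fin n) ℝ) : |rowSign x y k M| ≤ 1 := (abs_signProd _ _ _).le

theorem rowSign_mul_self (x y : EuclideanSpace ℝ (Fin n)) (k : Fin m)
    (M : Matrix (Fin m) (Fin n) ℝ) : rowSign x y k M * rowSign x y k M = 1 :=
  signProd_mul_self _ _ _

theorem angularEstimator_eq (M : Matrix (Fin m) (Fin n) ℝ) (x y : EuclideanSpace ℝ (Fin n)) :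
    angularEstimator M x y = (1 / (m : ℝ)) * ∑ k, rowSign x y k M := by
  simp only [angularEstimator, dotProduct, rowSign, signProd, inner_eq_dotProduct, Matrix.mulVec]

theorem measurable_angularEstimator (x y : EuclideanSpace ℝ (Fin n)) :
    Measurable fun M : Matrix (Fin m) (Fin n) ℝ => angularEstimator M x y := by
  simp only [angularEstimator_eq]
  exact (Finset.measurable_sum _ fun k _ => measurable_rowSign x y k).const_mul _

/-- The mean squared error of the estimator, in terms of the correlations between rows. -/
theorem MSE_angularEstimator {Ω : Type*} [MeasurableSpace Ω] {P : Measure Ω}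
    {ν : Measure (Matrix (Fin m) (Fin n) ℝ)} [IsProbabilityMeasure ν]
    {M : Ω → Matrix (Fin m) (Fin n) ℝ} (hM : HasLaw M ν P) (hm : m ≠ 0)
    (x y : EuclideanSpace ℝ (Fin n)) {K : ℝ} (hK : ∀ k, ∫ M, rowSign x y k M ∂ν = K) :
    MSE P (fun ω => angularEstimator (M ω) x y) K =
      (1 / (m : ℝ)) ^ 2 * ∑ k, ∑ l, ((∫ M, rowSign x y k M * rowSign x y l M ∂ν) - K ^ 2) := by
  rw [← integral_sq_average_sub hm (measurable_rowSign x y) (abs_rowSign_le x y) hK]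
  simp only [← angularEstimator_eq]
  exact hM.integral_comp (f := fun M => (angularEstimator M x y - K) ^ 2)
    ((measurable_angularEstimator x y).sub_const K |>.pow_const 2).aestronglyMeasurable

theorem isUnbiased_angularEstimator {Ω : Type*} [MeasurableSpace Ω] {P : Measure Ω}
    {ν : Measure (Matrix (Fin m) (Fin n) ℝ)} [IsProbabilityMeasure ν]
    {M : Ω → Matrix (Fin m) (Fin n) ℝ} (hM : HasLaw M ν P) (hm : m ≠ 0)
    (x y : EuclideanSpace ℝ (Fin n)) {K : ℝ} (hK : ∀ k, ∫ M, rowSign x y k M ∂ν = K) :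
    IsUnbiased P (fun ω => angularEstimator (M ω) x y) K := by
  have hi : ∀ k, Integrable (rowSign x y k) ν := fun k =>
    integrable_of_abs_le_one (measurable_rowSign x y k) (abs_rowSign_le x y k)
  have hint : Integrable (fun M : Matrix (Fin m) (Fin n) ℝ => angularEstimator M x y) ν := by
    simp only [angularEstimator_eq]
    exact (integrable_finsetSum _ fun k _ => hi k).const_mul _
  refine ⟨?_, ?_⟩
  · rw [← hM.map_eq] at hint
    exact hint.comp_aemeasurable hM.aemeasurable
  · have := hM.integral_comp (f := fun M => angularEstimator M x y)
      (measurable_angularEstimator x y).aestronglyMeasurable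
    refine this.trans ?_
    simp only [angularEstimator_eq]
    rw [integral_const_mul, integral_finsetSum _ fun k _ => hi k]
    have hm' : (m : ℝ) ≠ 0 := Nat.cast_ne_zero.2 hm
    simp only [hK, Finset.sum_const, Finset.card_univ, Fintype.card_fin, nsmul_eq_mul]
    field_simp

/-! ### Row correlations in the two matrix models. -/

theorem integral_pi_eval {ι : Type*} [Fintype ι] {X : Type*} [MeasurableSpace X] (μ : Measure X)
    [IsProbabilityMeasure μ] {f : X → ℝ} (hf : Measurable f) (i : ι) :
    ∫ ω, f (ω i) ∂Measure.pi (fun _ : ι => μ) = ∫ a, f a ∂μ := by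
  have h := integral_map (μ := Measure.pi fun _ : ι => μ) (f := f)
    (measurable_pi_apply i).aemeasurable hf.aestronglyMeasurable
  rw [← h]
  congr 1
  exact (measurePreserving_eval (fun _ : ι => μ) i).map_eq

theorem integral_pi_eval_mul {ι : Type*} [Fintype ι] {X : Type*} [MeasurableSpace X]
    (μ : Measure X) [IsProbabilityMeasure μ] {f g : X → ℝ} (hf : Measurable f) (hg : Measurable g)
    {i j : ι} (hij : i ≠ j) :
    ∫ ω, f (ω i) * g (ω j) ∂Measure.pi (fun _ : ι => μ) = (∫ a, f a ∂μ) * ∫ a, g a ∂μ := by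
  have h := (iIndepFun_pi (μ := fun _ : ι => μ) (X := fun _ a => a)
    fun _ => aemeasurable_id).indepFun hij
  have h' := h.comp hf hg
  rw [← integral_pi_eval μ hf i, ← integral_pi_eval μ hg j]
  exact h'.integral_fun_mul_eq_mul_integral
    (hf.comp (measurable_pi_apply i)).aestronglyMeasurable
    (hg.comp (measurable_pi_apply j)).aestronglyMeasurable

theorem integral_signProd_pi {x y : EuclideanSpace ℝ (Fin n)} (hx : x ≠ 0) (hy : y ≠ 0) :
    ∫ r, signProd x y (WithLp.toLp 2 r) ∂Measure.pi (fun _ : Fin n => gaussianReal 0 1) =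
      angularKernel x y := by
  rw [← integral_signProd_stdGaussian hx hy, ← map_pi_eq_stdGaussian,
    integral_map (WithLp.measurable_toLp 2 _).aemeasurable
      (measurable_signProd x y).aestronglyMeasurable]

theorem measurable_signProd_toLp (x y : EuclideanSpace ℝ (Fin n)) :
    Measurable fun r : Fin n → ℝ => signProd x y (WithLp.toLp 2 r) :=
  (measurable_signProd x y).comp (WithLp.measurable_toLp 2 _)

instance isProbabilityMeasure_gaussianLaw (m n : ℕ) : IsProbabilityMeasure (gaussianLaw m n) :=
  inferInstanceAs (IsProbabilityMeasure
    (Measure.pi fun _ : Fin m => Measure.pi fun _ : Fin n => gaussianReal 0 1))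

theorem integral_rowSign_gaussianLaw {x y : EuclideanSpace ℝ (Fin n)} (hx : x ≠ 0) (hy : y ≠ 0)
    (k : Fin m) : ∫ M, rowSign x y k M ∂gaussianLaw m n = angularKernel x y := by
  rw [← integral_signProd_pi hx hy]
  exact integral_pi_eval _ (measurable_signProd_toLp x y) k

theorem integral_rowSign_mul_gaussianLaw {x y : EuclideanSpace ℝ (Fin n)} (hx : x ≠ 0)
    (hy : y ≠ 0) {k l : Fin m} (hkl : k ≠ l) :
    ∫ M, rowSign x y k M * rowSign x y l M ∂gaussianLaw m n = angularKernel x y ^ 2 := by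
  rw [sq, ← integral_signProd_pi hx hy]
  exact integral_pi_eval_mul _ (measurable_signProd_toLp x y) (measurable_signProd_toLp x y) hkl

instance isProbabilityMeasure_chiLaw (n : ℕ) : IsProbabilityMeasure (chiLaw n) :=
  Measure.isProbabilityMeasure_map measurable_norm.aemeasurable

theorem chiLaw_pos (hn : 0 < n) : ∀ᵐ c ∂chiLaw n, 0 < c := by
  rw [chiLaw, ae_map_iff measurable_norm.aemeasurable measurableSet_Ioi]
  filter_upwards [stdGaussian_ne_zero hn] with g hg
  exact norm_pos_iff.2 hg

theorem measurable_diagonal_mul : Measurable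
    fun p : Matrix.orthogonalGroup (Fin n) ℝ × (Fin n → ℝ) =>
      Matrix.diagonal p.2 * (p.1 : Matrix (Fin n) (Fin n) ℝ) := by
  refine measurable_pi_lambda _ fun i => measurable_pi_lambda _ fun j => ?_
  simp only [Matrix.diagonal_mul]
  exact ((measurable_pi_apply i).comp measurable_snd).mul
    ((measurable_matrix_apply i j).comp (measurable_subtype_coe.comp measurable_fst))

instance isProbabilityMeasure_gaussianOrthogonalBlockLaw (n : ℕ) :
    IsProbabilityMeasure (gaussianOrthogonalBlockLaw n) :=
  Measure.isProbabilityMeasure_map measurable_diagonal_mul.aemeasurable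

/-- Signs are unchanged by positive scaling, so the `χ_n` lengths play no part and only the Haar
matrix remains. -/
theorem rowSign_diagonal_mul (x y : EuclideanSpace ℝ (Fin n))
    (O : Matrix.orthogonalGroup (Fin n) ℝ) {c : Fin n → ℝ} {k : Fin n} (hc : 0 < c k) :
    rowSign x y k (Matrix.diagonal c * (O : Matrix (Fin n) (Fin n) ℝ)) =
      signProd x y (rowAct O (EuclideanSpace.single k 1)) := by
  rw [← signProd_smul x y _ hc, rowSign]
  congr 1
  ext j
  simp [rowAct, Matrix.diagonal_mul]

theorem ae_pos_scale :
    ∀ᵐ p ∂(uniformOrthogonal n).prod (Measure.pi fun _ : Fin n => chiLaw n), ∀ k, 0 < p.2 k := by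
  rw [ae_all_iff]
  intro k
  exact Measure.quasiMeasurePreserving_snd.ae
    ((measurePreserving_eval (fun _ : Fin n => chiLaw n) k).quasiMeasurePreserving.ae
      (chiLaw_pos k.pos))

theorem integral_rowSign_blockLaw {x y : EuclideanSpace ℝ (Fin n)} (hx : x ≠ 0) (hy : y ≠ 0)
    (k : Fin n) : ∫ M, rowSign x y k M ∂gaussianOrthogonalBlockLaw n = angularKernel x y := by
  rw [gaussianOrthogonalBlockLaw, integral_map measurable_diagonal_mul.aemeasurable
    (measurable_rowSign x y k).aestronglyMeasurable, ← integral_signProd_row hx hy k,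
    integral_congr_ae (g := fun p => signProd x y (rowAct p.1 (EuclideanSpace.single k 1)))]
  · simpa using integral_fun_fst (μ := uniformOrthogonal n)
      (ν := Measure.pi fun _ : Fin n => chiLaw n)
      fun O => signProd x y (rowAct O (EuclideanSpace.single k 1))
  · filter_upwards [ae_pos_scale] with p hp using rowSign_diagonal_mul x y p.1 (hp k)

theorem integral_rowSign_mul_blockLaw (x y : EuclideanSpace ℝ (Fin n)) (k l : Fin n) :
    ∫ M, rowSign x y k M * rowSign x y l M ∂gaussianOrthogonalBlockLaw n =
      signCorr x y k (EuclideanSpace.single l 1) := by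
  rw [gaussianOrthogonalBlockLaw, integral_map measurable_diagonal_mul.aemeasurable
    (measurable_rowSign_mul x y k l).aestronglyMeasurable,
    integral_congr_ae (g := fun p => signProd x y (rowAct p.1 (EuclideanSpace.single k 1)) *
      signProd x y (rowAct p.1 (EuclideanSpace.single l 1)))]
  · simpa [signCorr] using integral_fun_fst (μ := uniformOrthogonal n)
      (ν := Measure.pi fun _ : Fin n => chiLaw n)
      fun O => signProd x y (rowAct O (EuclideanSpace.single k 1)) *
        signProd x y (rowAct O (EuclideanSpace.single l 1))
  · filter_upwards [ae_pos_scale] with p hp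
    simp only [rowSign_diagonal_mul x y p.1 (hp _)]

/-- The index of the block that contains the `k`-th row of the stack. -/
def blockIndex (n : ℕ) (k : Fin m) : Fin m := ⟨k / n, (Nat.div_le_self _ _).trans_lt k.isLt⟩

/-- The position of the `k`-th row of the stack inside its block. -/
def rowIndex (hn : 0 < n) (k : Fin m) : Fin n := ⟨k % n, Nat.mod_lt _ hn⟩

theorem measurable_stackRows : Measurable (stackRows m n) := by
  refine measurable_pi_lambda _ fun i => measurable_pi_lambda _ fun j => ?_
  exact (measurable_matrix_apply (rowIndex j.pos i) j).comp
    (measurable_pi_apply (X := fun _ : Fin m => Matrix (Fin n) (Fin n) ℝ) (blockIndex n i))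

instance isProbabilityMeasure_gaussianOrthogonalLaw (m n : ℕ) :
    IsProbabilityMeasure (gaussianOrthogonalLaw m n) :=
  Measure.isProbabilityMeasure_map measurable_stackRows.aemeasurable

theorem rowSign_stackRows (x y : EuclideanSpace ℝ (Fin n)) (hn : 0 < n) (k : Fin m)
    (B : Fin m → Matrix (Fin n) (Fin n) ℝ) :
    rowSign x y k (stackRows m n B) = rowSign x y (rowIndex hn k) (B (blockIndex n k)) := rfl

theorem integral_rowSign_gaussianOrthogonalLaw {x y : EuclideanSpace ℝ (Fin n)} (hx : x ≠ 0)
    (hy : y ≠ 0) (hn : 0 < n) (k : Fin m) :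
    ∫ M, rowSign x y k M ∂gaussianOrthogonalLaw m n = angularKernel x y := by
  rw [gaussianOrthogonalLaw, integral_map measurable_stackRows.aemeasurable
    (measurable_rowSign x y k).aestronglyMeasurable]
  simp only [rowSign_stackRows x y hn]
  rw [integral_pi_eval _ (measurable_rowSign x y _), integral_rowSign_blockLaw hx hy]

theorem rowIndex_ne {hn : 0 < n} {k l : Fin m} (hkl : k ≠ l) (h : blockIndex n k = blockIndex n l) :
    rowIndex hn k ≠ rowIndex hn l := fun h' => by
  have h1 : (k : ℕ) / n = l / n := congrArg Fin.val h
  have h2 : (k : ℕ) % n = l % n := congrArg Fin.val h'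
  exact hkl (Fin.ext (by rw [← Nat.div_add_mod (k : ℕ) n, h1, h2, Nat.div_add_mod]))

/-- Distinct rows of the same block are negatively correlated. -/
theorem integral_rowSign_mul_gaussianOrthogonalLaw_lt {x y : EuclideanSpace ℝ (Fin n)}
    (hx : x ≠ 0) (hy : y ≠ 0) (h : |inner ℝ x y| < ‖x‖ * ‖y‖) (hn : 0 < n) {k l : Fin m}
    (hkl : k ≠ l) (hblock : blockIndex n k = blockIndex n l) :
    ∫ M, rowSign x y k M * rowSign x y l M ∂gaussianOrthogonalLaw m n <
      angularKernel x y ^ 2 := by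
  rw [gaussianOrthogonalLaw, integral_map measurable_stackRows.aemeasurable
    (measurable_rowSign_mul x y k l).aestronglyMeasurable]
  simp only [rowSign_stackRows x y hn, hblock]
  rw [integral_pi_eval (f := fun M => rowSign x y (rowIndex hn k) M * rowSign x y (rowIndex hn l) M)
    _ (measurable_rowSign_mul x y _ _), integral_rowSign_mul_blockLaw]
  exact signCorr_orthogonal_lt hx hy h (rowIndex_ne hkl hblock)

theorem integral_rowSign_mul_gaussianOrthogonalLaw_of_block_ne {x y : EuclideanSpace ℝ (Fin n)}
    (hx : x ≠ 0) (hy : y ≠ 0) (hn : 0 < n) {k l : Fin m}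
    (hblock : blockIndex n k ≠ blockIndex n l) :
    ∫ M, rowSign x y k M * rowSign x y l M ∂gaussianOrthogonalLaw m n =
      angularKernel x y ^ 2 := by
  rw [gaussianOrthogonalLaw, integral_map measurable_stackRows.aemeasurable
    (measurable_rowSign_mul x y k l).aestronglyMeasurable]
  simp only [rowSign_stackRows x y hn]
  rw [integral_pi_eval_mul _ (measurable_rowSign x y _) (measurable_rowSign x y _) hblock,
    integral_rowSign_blockLaw hx hy, integral_rowSign_blockLaw hx hy, sq]

/-- Three cases: equal rows give `1` in both models, distinct blocks are independent, and distinct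
rows of one block fall below `K²`. -/
theorem integral_rowSign_mul_gaussianOrthogonalLaw_le {x y : EuclideanSpace ℝ (Fin n)}
    (hx : x ≠ 0) (hy : y ≠ 0) (h : |inner ℝ x y| < ‖x‖ * ‖y‖) (hn : 0 < n) (k l : Fin m) :
    ∫ M, rowSign x y k M * rowSign x y l M ∂gaussianOrthogonalLaw m n ≤
      ∫ M, rowSign x y k M * rowSign x y l M ∂gaussianLaw m n := by
  rcases eq_or_ne k l with rfl | hkl
  · simp [rowSign_mul_self]
  rw [integral_rowSign_mul_gaussianLaw hx hy hkl]
  by_cases hblock : blockIndex n k = blockIndex n l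
  · exact (integral_rowSign_mul_gaussianOrthogonalLaw_lt hx hy h hn hkl hblock).le
  · exact (integral_rowSign_mul_gaussianOrthogonalLaw_of_block_ne hx hy hn hblock).le

end meanSquaredError

/-! ### Conclusion. -/

theorem abs_inner_lt_of_linearIndependent {n : ℕ} {x y : EuclideanSpace ℝ (Fin n)}
    (h : LinearIndependent ℝ ![x, y]) : |inner ℝ x y| < ‖x‖ * ‖y‖ := by
  refine lt_of_le_of_ne (abs_real_inner_le_norm x y) fun heq => ?_
  have hx : x ≠ 0 := h.ne_zero 0
  have hy : y ≠ 0 := h.ne_zero 1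
  have h1 : |inner ℝ x y / (‖x‖ * ‖y‖)| = 1 := by
    rw [abs_div, heq, abs_of_pos (mul_pos (norm_pos_iff.2 hx) (norm_pos_iff.2 hy)), div_self
      (mul_pos (norm_pos_iff.2 hx) (norm_pos_iff.2 hy)).ne']
  obtain ⟨-, r, hr, hyr⟩ := (abs_real_inner_div_norm_mul_norm_eq_one_iff x y).1 h1
  have := (LinearIndependent.pair_iff.1 h) r (-1) (by rw [hyr]; simp)
  exact hr this.1

theorem theorem6 (m n : ℕ) (hm : 1 ≤ m)
    (x y : EuclideanSpace ℝ (Fin n)) (hx : x ≠ 0) (hy : y ≠ 0)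
    {Ω Ω' : Type*} [MeasurableSpace Ω] [MeasurableSpace Ω']
    (P : Measure Ω) (P' : Measure Ω') [IsProbabilityMeasure P] [IsProbabilityMeasure P']
    (G : Ω → Matrix (Fin m) (Fin n) ℝ) (hG : HasLaw G (gaussianLaw m n) P)
    (Gort : Ω' → Matrix (Fin m) (Fin n) ℝ) (hGort : HasLaw Gort (gaussianOrthogonalLaw m n) P') :
    IsUnbiased P' (fun ω => angularEstimator (Gort ω) x y) (angularKernel x y) ∧
    (2 ≤ m → LinearIndependent ℝ ![x, y] →
      MSE P' (fun ω => angularEstimator (Gort ω) x y) (angularKernel x y) <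
        MSE P (fun ω => angularEstimator (G ω) x y) (angularKernel x y)) := by
  have hm0 : m ≠ 0 := by lia
  have hn : 0 < n := by
    refine Nat.pos_of_ne_zero fun h => hx ?_
    subst h
    exact Subsingleton.elim _ _
  have hK := fun k : Fin m => integral_rowSign_gaussianOrthogonalLaw hx hy hn k
  refine ⟨isUnbiased_angularEstimator hGort hm0 x y hK, fun hm2 hli => ?_⟩
  have hinner := abs_inner_lt_of_linearIndependent hli
  have hn2 : 2 ≤ n := by simpa using hli.fintype_card_le_finrank
  rw [MSE_angularEstimator hGort hm0 x y hK, MSE_angularEstimator hG hm0 x y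
    fun k => integral_rowSign_gaussianLaw hx hy k]
  refine mul_lt_mul_of_pos_left ?_ (by positivity)
  have hle := integral_rowSign_mul_gaussianOrthogonalLaw_le (m := m) hx hy hinner hn
  -- One strict term is enough: rows `0` and `1`, which exist as `m ≥ 2` and share the first block
  -- because independence of `x, y` forces `n ≥ 2`.
  refine Finset.sum_lt_sum (fun k _ => Finset.sum_le_sum fun l _ => sub_le_sub_right (hle k l) _)
    ⟨⟨0, by lia⟩, Finset.mem_univ _, Finset.sum_lt_sum (fun l _ => sub_le_sub_right (hle _ l) _)
      ⟨⟨1, by lia⟩, Finset.mem_univ _, sub_lt_sub_right ?_ _⟩⟩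
  rw [integral_rowSign_mul_gaussianLaw hx hy (by simp)]
  refine integral_rowSign_mul_gaussianOrthogonalLaw_lt hx hy hinner hn (by simp) (Fin.ext ?_)
  simp only [blockIndex, Nat.zero_div]
  exact (Nat.div_eq_of_lt (by lia)).symm
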